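/- Let $\varepsilon>0$ be fixed, let $p>2$ be a fixed prime, and let $\alpha_1,\alpha_2,\alpha_3$ be fixed integers coprime to $p$. With Legendre symbols $\left(\frac{\cdot}{p}\right)$, put $$s_p(\alpha_1,\alpha_2,\alpha_3):=2+\left(\frac{-\alpha_1\alpha_2}{p}\right)+\left(\frac{-\alpha_1\alpha_3}{p}\right)+\left(\frac{-\alpha_2\alpha_3}{p}\right),\qquad C_p(\alpha_1,\alpha_2,\alpha_3):=\frac{(p-s_p(\alpha_1,\alpha_2,\alpha_3))(p-1)}{p^2},$$ and assume that $p>s_p(\alpha_1,\alpha_2,\alpha_3)$. Let $\Phi:\mathbb{R}\to\mathbb{R}_{\ge 0}$ be a Schwartz function with Fourier transform $\hat\Phi$, so that $\hat\Phi(0)=\int_{\mathbb{R}}\Phi(x)\,dx$. For $n\in\mathbb{N}$ and real $N>0$ set $q:=p^n$ and $$T(n,N):=\sum_{\substack{(x_1,x_2,x_3)\in\mathbb{Z}^3\\ \gcd(x_1x_2x_3,p)=1\\ \alpha_1x_1^2+\alpha_2x_2^2+\alpha_3x_3^2\equiv 0\bmod q}}\Phi\left(\frac{x_1}{N}\right)\Phi\left(\frac{x_2}{N}\right)\Phi\left(\frac{x_3}{N}\right),$$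 $$M(n,N):=\hat\Phi(0)^3\cdot C_p(\alpha_1,\alpha_2,\alpha_3)\cdot\frac{N^3}{q}.$$ Then the series $T(n,N)$ converges for all $n\in\mathbb{N}$ and all real $N>0$, and, as $n\to\infty$, $T(n,N)\sim M(n,N)$ uniformly in $N\ge q^{1/2+\varepsilon}$; that is, for every $\delta>0$ there is $n_0$ such that $|T(n,N)-M(n,N)|\le\delta\, M(n,N)$ for all $n\ge n_0$ and all real $N\ge q^{1/2+\varepsilon}$. -/

import Mathlib

open scoped SchwartzMap FourierTransform

noncomputable section

namespace QuadCong

/-- The quantity `s_p(α₁, α₂, α₃)`, a sum of Legendre symbols. -/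
def s (p : ℕ) [Fact p.Prime] (α₁ α₂ α₃ : ℤ) : ℤ :=
  2 + legendreSym p (-(α₁ * α₂)) + legendreSym p (-(α₁ * α₃)) + legendreSym p (-(α₂ * α₃))

/-- The constant `C_p(α₁, α₂, α₃) = (p - s_p(α₁, α₂, α₃)) (p - 1) / p ^ 2`. -/
def C (p : ℕ) [Fact p.Prime] (α₁ α₂ α₃ : ℤ) : ℝ :=
  (((p : ℝ) - (s p α₁ α₂ α₃ : ℝ)) * ((p : ℝ) - 1)) / (p : ℝ) ^ 2

/-- Integer solutions of `α₁ x₁² + α₂ x₂² + α₃ x₃² ≡ 0 mod q` with `x₁ x₂ x₃` coprime to `p`. -/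
def solutions (p q : ℕ) (α₁ α₂ α₃ : ℤ) : Set (ℤ × ℤ × ℤ) :=
  {x | IsCoprime (x.1 * x.2.1 * x.2.2) (p : ℤ) ∧
    α₁ * x.1 ^ 2 + α₂ * x.2.1 ^ 2 + α₃ * x.2.2 ^ 2 ≡ 0 [ZMOD (q : ℤ)]}

/-- The weight of an integer triple. -/
def weight (Φ : 𝓢(ℝ, ℝ)) (N : ℝ) (x : ℤ × ℤ × ℤ) : ℝ :=
  Φ ((x.1 : ℝ) / N) * Φ ((x.2.1 : ℝ) / N) * Φ ((x.2.2 : ℝ) / N)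

/-- The value at `0` of the Fourier transform of the real-valued function `Φ`, as a real number. -/
def fourierZero (Φ : 𝓢(ℝ, ℝ)) : ℝ := (𝓕 (fun x : ℝ => (Φ x : ℂ)) 0).re

/-- The Fourier transform at `0` is a real number, so nothing is lost in `fourierZero`. -/
theorem ofReal_fourierZero (Φ : 𝓢(ℝ, ℝ)) :
    (fourierZero Φ : ℂ) = 𝓕 (fun x : ℝ => (Φ x : ℂ)) 0 := by
  have h : 𝓕 (fun x : ℝ => (Φ x : ℂ)) 0 = ((∫ x, Φ x : ℝ) : ℂ) := by
    rw [Real.fourier_eq']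
    simp [integral_complex_ofReal]
  rw [fourierZero, h, Complex.ofReal_re]

end QuadCong

end

noncomputable section

namespace QuadCong

/-! ### Exponential sums over unit solutions modulo a prime power -/

/-! Poisson summation in each residue class modulo q (`tsum_solutions_eq`) turns T into (N/q)³ times
the sum over h ∈ ℤ³ of Φ̂(h₁N/q) Φ̂(h₂N/q) Φ̂(h₃N/q) G(h), where G(h) = `expSum` adds e(h·x/q) over
the unit solutions x modulo q. The frequency h = 0 gives M exactly, because Jacobi sums modulo p and
Hensel lifting count C_p q² unit solutions (`card_unitSolutions`). As N ≥ q^(1/2+ε), the decay of Φ̂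
leaves only 0 < |h| ≤ X = q^(1/2-ε/2), and it remains to see that the sum of |G(h)| over these h is
o(q²).

This is p-adic stationary phase (`sum_addChar_unitSolutions`). Infinitesimal rotations of step p^k
with 2k ≥ n preserve the quadratic form Q modulo q. Averaging the phase over them, and over scalings
by 1 + pt, kills every x except those where h is proportional to the gradient of Q modulo p^(n-k)
and p(h·x) ≡ 0. Such points are few, so |G(h)| ≪ q^(3/2) p^r with p^r the power of p in the content
of h (`norm_expSum_le`). If one exists at all, then p Q*(h) ≡ 0 modulo q for the dual form Q*; since
p|Q*(h)| ≪ X² is smaller than q, Q*(h) = 0 in ℤ (`dualForm_eq_zero_of_expSum_ne_zero`).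

So only integer points of a conic contribute. Primitive ones of height at most X number O(X)
(`card_primitivePoints_le`): two of them agreeing projectively modulo p^m have polar form divisible
by p^(2m), hence zero once p^m exceeds a multiple of X, and then they coincide up to sign. Summing
over contents costs two logarithms, for a total of O(n² q^(2-ε/2)). -/

/-- Summing an additive character along a family of permutations that translate the phase
linearly leaves only the stationary points. -/
theorem sum_addChar_eq_sum_filter {X R : Type*} [DecidableEq X] [CommRing R] [Fintype R]
    [DecidableEq R] {ψ : AddChar R ℂ} (hψ : ψ.IsPrimitive) (S : Finset X) (f c : X → R)
    (σ : R → X → X) (hmaps : ∀ t, ∀ x ∈ S, σ t x ∈ S)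
    (hinj : ∀ t, Function.Injective (σ t)) (hf : ∀ t, ∀ x ∈ S, f (σ t x) = f x + t * c x) :
    ∑ x ∈ S, ψ (f x) = ∑ x ∈ S.filter (fun x => c x = 0), ψ (f x) := by
  have hshift : ∀ t : R, ∑ x ∈ S, ψ (f x) = ∑ x ∈ S, ψ (f x) * ψ (t * c x) := by
    intro t
    have himg : S.image (σ t) = S := by
      apply Finset.eq_of_subset_of_card_le
      · intro y hy
        obtain ⟨x, hx, rfl⟩ := Finset.mem_image.1 hy
        exact hmaps t x hx
      · rw [Finset.card_image_of_injective _ (hinj t)]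
    conv_lhs => rw [← himg]
    rw [Finset.sum_image (fun x _ y _ h => hinj t h)]
    refine Finset.sum_congr rfl fun x hx => ?_
    rw [hf t x hx, AddChar.map_add_eq_mul]
  have hcard : (Fintype.card R : ℂ) ≠ 0 := by
    exact_mod_cast Fintype.card_ne_zero
  -- Average over all t: orthogonality of characters annihilates each x with `c x ≠ 0`.
  apply mul_left_cancel₀ hcard
  calc (Fintype.card R : ℂ) * ∑ x ∈ S, ψ (f x)
      = ∑ t : R, ∑ x ∈ S, ψ (f x) := by simp
    _ = ∑ t : R, ∑ x ∈ S, ψ (f x) * ψ (t * c x) :=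
        Finset.sum_congr rfl fun t _ => hshift t
    _ = ∑ x ∈ S, ψ (f x) * ∑ t : R, ψ (t * c x) := by
        rw [Finset.sum_comm]
        simp_rw [Finset.mul_sum]
    _ = ∑ x ∈ S, if c x = 0 then (Fintype.card R : ℂ) * ψ (f x) else 0 := by
        refine Finset.sum_congr rfl fun x _ => ?_
        rw [AddChar.sum_mulShift _ hψ]
        split_ifs <;> simp [mul_comm]
    _ = (Fintype.card R : ℂ) * ∑ x ∈ S.filter (fun x => c x = 0), ψ (f x) := by
        rw [← Finset.sum_filter, Finset.mul_sum]

/-- Solutions with unit coordinates of a diagonal ternary quadratic equation modulo `p ^ n`. -/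
def unitSolutions (p n : ℕ) [NeZero (p ^ n)] (α₁ α₂ α₃ : ℤ) :
    Finset (ZMod (p ^ n) × ZMod (p ^ n) × ZMod (p ^ n)) :=
  Finset.univ.filter fun x => (IsUnit x.1 ∧ IsUnit x.2.1 ∧ IsUnit x.2.2) ∧
    (α₁ : ZMod (p ^ n)) * x.1 ^ 2 + α₂ * x.2.1 ^ 2 + α₃ * x.2.2 ^ 2 = 0

/-- The linear form with coefficients `h`. -/
def linForm {R : Type*} [CommRing R] (h x : R × R × R) : R :=
  h.1 * x.1 + h.2.1 * x.2.1 + h.2.2 * x.2.2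

/-- An infinitesimal rotation of the quadratic form with diagonal coefficients `a`, with
axis `w` and step `e`. -/
def rotate {R : Type*} [CommRing R] (a w : R × R × R) (e : R) (x : R × R × R) : R × R × R :=
  (x.1 + e * (a.2.1 * a.2.2 * (w.2.1 * x.2.2 - w.2.2 * x.2.1)),
    x.2.1 + e * (a.1 * a.2.2 * (w.2.2 * x.1 - w.1 * x.2.2)),
    x.2.2 + e * (a.1 * a.2.1 * (w.1 * x.2.1 - w.2.1 * x.1)))

/-- The derivative of `linForm h` along `rotate a w`. -/
def rotForm {R : Type*} [CommRing R] (a w h x : R × R × R) : R :=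
  h.1 * (a.2.1 * a.2.2 * (w.2.1 * x.2.2 - w.2.2 * x.2.1)) +
    h.2.1 * (a.1 * a.2.2 * (w.2.2 * x.1 - w.1 * x.2.2)) +
    h.2.2 * (a.1 * a.2.1 * (w.1 * x.2.1 - w.2.1 * x.1))

/-- The rotation is id + eA with A linear, and (id - eA)(id + eA) = id - e²A². -/
theorem rotate_injective {R : Type*} [CommRing R] (a w : R × R × R) {e : R} (he : e * e = 0) :
    Function.Injective (rotate a w e) := by
  apply Function.LeftInverse.injective (g := rotate a w (-e))
  rintro ⟨x, y, z⟩
  simp only [rotate, Prod.mk.injEq]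
  refine ⟨?_, ?_, ?_⟩
  · linear_combination (-(a.2.1 * a.2.2 * (w.2.1 * (a.1 * a.2.1 * (w.1 * y - w.2.1 * x)) -
      w.2.2 * (a.1 * a.2.2 * (w.2.2 * x - w.1 * z))))) * he
  · linear_combination (-(a.1 * a.2.2 * (w.2.2 * (a.2.1 * a.2.2 * (w.2.1 * z - w.2.2 * y)) -
      w.1 * (a.1 * a.2.1 * (w.1 * y - w.2.1 * x))))) * he
  · linear_combination (-(a.1 * a.2.1 * (w.1 * (a.1 * a.2.2 * (w.2.2 * x - w.1 * z)) -
      w.2.1 * (a.2.1 * a.2.2 * (w.2.1 * z - w.2.2 * y))))) * he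

theorem linForm_rotate {R : Type*} [CommRing R] (a w h x : R × R × R) (e t : R) :
    linForm h (rotate a w (e * t) x) = linForm h x + t * (e * rotForm a w h x) := by
  simp only [linForm, rotate, rotForm]
  ring

/-- The change is of order e² = 0. Hence stationarity about one axis survives rotation about
another, and the conditions can be imposed one after the other. -/
theorem mul_rotForm_rotate {R : Type*} [CommRing R] (a v w h x : R × R × R) {e : R}
    (he : e * e = 0) (t : R) :
    e * rotForm a v h (rotate a w (e * t) x) = e * rotForm a v h x := by
  have key : e * rotForm a v h (rotate a w (e * t) x) = e * rotForm a v h x +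
      e * e * t * rotForm a v h (rotate a w 1 x - x) := by
    simp only [rotForm, rotate, Prod.fst_sub, Prod.snd_sub]
    ring
  rw [key, he]
  ring

/-- The first-order change of the form is a multiple of x·(w × x) = 0, and the second-order one
carries p^(2k) = 0. The increments are nilpotent because k > 0, so units stay units. -/
theorem rotate_mem_unitSolutions {p n k : ℕ} [NeZero (p ^ n)] (hk : 0 < k) (hkn : n ≤ 2 * k)
    {α₁ α₂ α₃ : ℤ} (w : ZMod (p ^ n) × ZMod (p ^ n) × ZMod (p ^ n)) (t : ZMod (p ^ n))
    {x : ZMod (p ^ n) × ZMod (p ^ n) × ZMod (p ^ n)} (hx : x ∈ unitSolutions p n α₁ α₂ α₃) :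
    rotate ((α₁ : ZMod (p ^ n)), (α₂ : ZMod (p ^ n)), (α₃ : ZMod (p ^ n))) w
      ((p : ZMod (p ^ n)) ^ k * t) x ∈ unitSolutions p n α₁ α₂ α₃ := by
  have hp : ∀ m, n ≤ m → (p : ZMod (p ^ n)) ^ m = 0 := by
    intro m hm
    rw [← Nat.cast_pow, ZMod.natCast_eq_zero_iff]
    exact pow_dvd_pow _ hm
  have hnil : ∀ s : ZMod (p ^ n), IsNilpotent ((p : ZMod (p ^ n)) ^ k * t * s) := by
    intro s
    refine ⟨n, ?_⟩
    rw [mul_pow, mul_pow, ← pow_mul, hp (k * n) (Nat.le_mul_of_pos_left n hk)]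
    ring
  obtain ⟨x, y, z⟩ := x
  simp only [unitSolutions, Finset.mem_filter, Finset.mem_univ, true_and] at hx ⊢
  obtain ⟨⟨h1, h2, h3⟩, hQ⟩ := hx
  simp only [rotate]
  refine ⟨⟨?_, ?_, ?_⟩, ?_⟩
  · exact (hnil _).isUnit_add_left_of_commute h1 (Commute.all _ _)
  · exact (hnil _).isUnit_add_left_of_commute h2 (Commute.all _ _)
  · exact (hnil _).isUnit_add_left_of_commute h3 (Commute.all _ _)
  · have hk2 : (p : ZMod (p ^ n)) ^ k * (p : ZMod (p ^ n)) ^ k = 0 := by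
      rw [← pow_add]
      exact hp _ (by omega)
    linear_combination hQ + (t ^ 2 * ((α₁ : ZMod (p ^ n)) *
      ((α₂ : ZMod (p ^ n)) * α₃ * (w.2.1 * z - w.2.2 * y)) ^ 2 + α₂ *
      ((α₁ : ZMod (p ^ n)) * α₃ * (w.2.2 * x - w.1 * z)) ^ 2 + α₃ *
      ((α₁ : ZMod (p ^ n)) * α₂ * (w.1 * y - w.2.1 * x)) ^ 2)) * hk2

/-- The points of `unitSolutions` where the phase `linForm h` is stationary. -/
def stationarySet (p n k : ℕ) [NeZero (p ^ n)] (α₁ α₂ α₃ : ℤ)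
    (h : ZMod (p ^ n) × ZMod (p ^ n) × ZMod (p ^ n)) :
    Finset (ZMod (p ^ n) × ZMod (p ^ n) × ZMod (p ^ n)) :=
  (((((unitSolutions p n α₁ α₂ α₃).filter fun x =>
    (p : ZMod (p ^ n)) ^ k * rotForm (↑α₁, ↑α₂, ↑α₃) (1, 0, 0) h x = 0).filter fun x =>
    (p : ZMod (p ^ n)) ^ k * rotForm (↑α₁, ↑α₂, ↑α₃) (0, 1, 0) h x = 0).filter fun x =>
    (p : ZMod (p ^ n)) ^ k * rotForm (↑α₁, ↑α₂, ↑α₃) (0, 0, 1) h x = 0)).filter fun x =>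
    (p : ZMod (p ^ n)) * linForm h x = 0

theorem sum_addChar_unitSolutions {p n k : ℕ} [NeZero (p ^ n)] (hk : 0 < k) (hkn : n ≤ 2 * k)
    (α₁ α₂ α₃ : ℤ) (h : ZMod (p ^ n) × ZMod (p ^ n) × ZMod (p ^ n))
    {ψ : AddChar (ZMod (p ^ n)) ℂ} (hψ : ψ.IsPrimitive) :
    ∑ x ∈ unitSolutions p n α₁ α₂ α₃, ψ (linForm h x) =
      ∑ x ∈ stationarySet p n k α₁ α₂ α₃ h, ψ (linForm h x) := by
  have hp : ∀ m, n ≤ m → (p : ZMod (p ^ n)) ^ m = 0 := by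
    intro m hm
    rw [← Nat.cast_pow, ZMod.natCast_eq_zero_iff]
    exact pow_dvd_pow _ hm
  have hk2 : (p : ZMod (p ^ n)) ^ k * (p : ZMod (p ^ n)) ^ k = 0 := by
    rw [← pow_add]
    exact hp _ (by omega)
  have hk2' : ∀ t, ((p : ZMod (p ^ n)) ^ k * t) * ((p : ZMod (p ^ n)) ^ k * t) = 0 := by
    intro t
    linear_combination t ^ 2 * hk2
  have hunit : ∀ t : ZMod (p ^ n), IsUnit (1 + p * t) := by
    intro t
    refine IsNilpotent.isUnit_add_left_of_commute ⟨n, ?_⟩ isUnit_one (Commute.all _ _)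
    rw [mul_pow, hp n le_rfl, zero_mul]
  rw [stationarySet]
  rw [sum_addChar_eq_sum_filter hψ _ (linForm h)
    (fun x => (p : ZMod (p ^ n)) ^ k * rotForm (↑α₁, ↑α₂, ↑α₃) (1, 0, 0) h x)
    (fun t => rotate (↑α₁, ↑α₂, ↑α₃) (1, 0, 0) ((p : ZMod (p ^ n)) ^ k * t))
    (fun t x hx => rotate_mem_unitSolutions hk hkn _ t hx)
    (fun t => rotate_injective _ _ (hk2' t)) (fun t x _ => linForm_rotate _ _ _ _ _ _)]
  rw [sum_addChar_eq_sum_filter hψ _ (linForm h)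
    (fun x => (p : ZMod (p ^ n)) ^ k * rotForm (↑α₁, ↑α₂, ↑α₃) (0, 1, 0) h x)
    (fun t => rotate (↑α₁, ↑α₂, ↑α₃) (0, 1, 0) ((p : ZMod (p ^ n)) ^ k * t))
    (fun t x hx => by
      rw [Finset.mem_filter] at hx ⊢
      exact ⟨rotate_mem_unitSolutions hk hkn _ t hx.1, by
        rw [mul_rotForm_rotate _ _ _ _ _ hk2]; exact hx.2⟩)
    (fun t => rotate_injective _ _ (hk2' t)) (fun t x _ => linForm_rotate _ _ _ _ _ _)]
  rw [sum_addChar_eq_sum_filter hψ _ (linForm h)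
    (fun x => (p : ZMod (p ^ n)) ^ k * rotForm (↑α₁, ↑α₂, ↑α₃) (0, 0, 1) h x)
    (fun t => rotate (↑α₁, ↑α₂, ↑α₃) (0, 0, 1) ((p : ZMod (p ^ n)) ^ k * t))
    (fun t x hx => by
      rw [Finset.mem_filter, Finset.mem_filter] at hx ⊢
      exact ⟨⟨rotate_mem_unitSolutions hk hkn _ t hx.1.1, by
        rw [mul_rotForm_rotate _ _ _ _ _ hk2]; exact hx.1.2⟩, by
        rw [mul_rotForm_rotate _ _ _ _ _ hk2]; exact hx.2⟩)
    (fun t => rotate_injective _ _ (hk2' t)) (fun t x _ => linForm_rotate _ _ _ _ _ _)]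
  -- The last symmetry is scaling by 1 + pt: all earlier conditions are homogeneous, and the phase
  -- moves by t · p · `linForm h x`.
  refine sum_addChar_eq_sum_filter hψ _ (linForm h)
    (fun x => (p : ZMod (p ^ n)) * linForm h x)
    (fun t x => ((1 + p * t) * x.1, (1 + p * t) * x.2.1, (1 + p * t) * x.2.2)) ?_ ?_ ?_
  · rintro t ⟨x, y, z⟩ hx
    simp only [Finset.mem_filter, unitSolutions, Finset.mem_univ, true_and] at hx ⊢
    obtain ⟨⟨⟨⟨⟨h1, h2, h3⟩, hQ⟩, h4⟩, h5⟩, h6⟩ := hx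
    refine ⟨⟨⟨⟨⟨(hunit t).mul h1, (hunit t).mul h2, (hunit t).mul h3⟩, ?_⟩, ?_⟩, ?_⟩, ?_⟩
    · linear_combination (1 + p * t) ^ 2 * hQ
    · simp only [rotForm] at h4 ⊢
      linear_combination (1 + p * t) * h4
    · simp only [rotForm] at h5 ⊢
      linear_combination (1 + p * t) * h5
    · simp only [rotForm] at h6 ⊢
      linear_combination (1 + p * t) * h6
  · rintro t ⟨x, y, z⟩ ⟨x', y', z'⟩ hxy
    simp only [Prod.mk.injEq] at hxy
    rw [(hunit t).mul_right_inj, (hunit t).mul_right_inj, (hunit t).mul_right_inj] at hxy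
    simp [hxy]
  · intro t x _
    simp only [linForm]
    ring

theorem isUnit_intCast_zmod_pow {p : ℕ} (n : ℕ) {a : ℤ} (ha : IsCoprime a (p : ℤ)) :
    IsUnit (a : ZMod (p ^ n)) := by
  rw [ZMod.coe_int_isUnit_iff_isCoprime]
  push_cast
  exact ha.symm.pow_left

/-- About a coordinate axis, `rotForm` is a unit times a 2 × 2 minor of h against (α₁x₁, α₂x₂,
α₃x₃). Stationarity thus says that h is proportional to the gradient modulo p^(n-k). -/
theorem mem_stationarySet {p n k : ℕ} [NeZero (p ^ n)] {α₁ α₂ α₃ : ℤ}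
    (h₁ : IsCoprime α₁ (p : ℤ)) (h₂ : IsCoprime α₂ (p : ℤ)) (h₃ : IsCoprime α₃ (p : ℤ))
    {h x : ZMod (p ^ n) × ZMod (p ^ n) × ZMod (p ^ n)}
    (hx : x ∈ stationarySet p n k α₁ α₂ α₃ h) :
    x ∈ unitSolutions p n α₁ α₂ α₃ ∧ (p : ZMod (p ^ n)) * linForm h x = 0 ∧
    (p : ZMod (p ^ n)) ^ k * (α₂ * x.2.1 * h.1 - α₁ * x.1 * h.2.1) = 0 ∧
    (p : ZMod (p ^ n)) ^ k * (α₃ * x.2.2 * h.1 - α₁ * x.1 * h.2.2) = 0 ∧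
    (p : ZMod (p ^ n)) ^ k * (α₃ * x.2.2 * h.2.1 - α₂ * x.2.1 * h.2.2) = 0 := by
  rw [stationarySet, Finset.mem_filter, Finset.mem_filter, Finset.mem_filter,
    Finset.mem_filter] at hx
  obtain ⟨⟨⟨⟨hS, h4⟩, h5⟩, h6⟩, h7⟩ := hx
  simp only [rotForm] at h4 h5 h6
  refine ⟨hS, h7, ?_, ?_, ?_⟩
  · apply (isUnit_intCast_zmod_pow n h₃).mul_left_cancel
    linear_combination -h6
  · apply (isUnit_intCast_zmod_pow n h₂).mul_left_cancel
    linear_combination h5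
  · apply (isUnit_intCast_zmod_pow n h₁).mul_left_cancel
    linear_combination -h4

theorem exists_eq_pow_mul_of_pow_mul_eq_zero {p n k : ℕ} [Fact p.Prime] (hk : k ≤ n)
    {a : ZMod (p ^ n)} (ha : (p : ZMod (p ^ n)) ^ k * a = 0) :
    ∃ b, a = (p : ZMod (p ^ n)) ^ (n - k) * b := by
  obtain ⟨a, rfl⟩ := ZMod.intCast_surjective a
  have hp : (p : ℤ) ≠ 0 := by exact_mod_cast (Fact.out : p.Prime).ne_zero
  have h : ((p ^ n : ℕ) : ℤ) ∣ (p : ℤ) ^ k * a := by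
    rw [← ZMod.intCast_zmod_eq_zero_iff_dvd]
    push_cast
    exact ha
  rw [Nat.cast_pow, show n = k + (n - k) by omega, pow_add] at h
  obtain ⟨b, hb⟩ := (mul_dvd_mul_iff_left (pow_ne_zero k hp)).1 h
  refine ⟨b, ?_⟩
  rw [hb]
  push_cast
  ring

/-- The dual quadratic form vanishes, up to a factor `p`, at every frequency that has a
stationary point. -/
theorem dualForm_eq_zero_of_mem_stationarySet {p n k : ℕ} [Fact p.Prime] {α₁ α₂ α₃ : ℤ}
    (hkn : k ≤ n) (hk : 2 * k ≤ n + 1)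
    (h₁ : IsCoprime α₁ (p : ℤ)) (h₂ : IsCoprime α₂ (p : ℤ)) (h₃ : IsCoprime α₃ (p : ℤ))
    {h x : ZMod (p ^ n) × ZMod (p ^ n) × ZMod (p ^ n)}
    (hx : x ∈ stationarySet p n k α₁ α₂ α₃ h) :
    (p : ZMod (p ^ n)) * (α₂ * α₃ * h.1 ^ 2 + α₁ * α₃ * h.2.1 ^ 2 + α₁ * α₂ * h.2.2 ^ 2) = 0 := by
  obtain ⟨hS, h7, h4, h5, h6⟩ := mem_stationarySet h₁ h₂ h₃ hx
  simp only [unitSolutions, Finset.mem_filter, Finset.mem_univ, true_and] at hS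
  obtain ⟨⟨u1, u2, u3⟩, hQ⟩ := hS
  obtain ⟨x, y, z⟩ := x
  obtain ⟨a, b, c⟩ := h
  simp only [linForm] at *
  obtain ⟨d, hd⟩ := exists_eq_pow_mul_of_pow_mul_eq_zero hkn h4
  obtain ⟨e, he⟩ := exists_eq_pow_mul_of_pow_mul_eq_zero hkn h5
  -- The exponent 1 + 2(n - k) reaches n exactly when 2k ≤ n + 1; the extra factor p is what allows
  -- odd n.
  have hpp : (p : ZMod (p ^ n)) * ((p : ZMod (p ^ n)) ^ (n - k) * (p : ZMod (p ^ n)) ^ (n - k)) = 0 := by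
    rw [← pow_add, ← pow_succ', ← Nat.cast_pow, ZMod.natCast_eq_zero_iff]
    exact pow_dvd_pow _ (by omega)
  have hdd : (p : ZMod (p ^ n)) * (α₂ * y * a - α₁ * x * b) ^ 2 = 0 := by
    rw [hd]
    linear_combination d ^ 2 * hpp
  have hee : (p : ZMod (p ^ n)) * (α₃ * z * a - α₁ * x * c) ^ 2 = 0 := by
    rw [he]
    linear_combination e ^ 2 * hpp
  -- A Lagrange-type identity: (α₁x₁)² times the dual form at h is a combination of squared minors,
  -- the form at x and h·x, each of which vanishes after multiplication by p.
  apply (((isUnit_intCast_zmod_pow n h₁).mul u1).pow 2).mul_left_cancel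
  linear_combination (α₁ * α₃ : ZMod (p ^ n)) * hdd + (α₁ * α₂ : ZMod (p ^ n)) * hee
    + (p * a ^ 2 * α₁ * α₂ * α₃ - 2 * p * a ^ 2 * α₁ * α₂ * α₃ : ZMod (p ^ n)) * hQ
    + (2 * a * α₁ * α₂ * α₃ * α₁ * x : ZMod (p ^ n)) * h7

/-- Reduction from `ZMod (p ^ n)` to `ZMod p`. -/
def modP (p : ℕ) {n : ℕ} (hn : n ≠ 0) : ZMod (p ^ n) →+* ZMod p :=
  ZMod.castHom (dvd_pow_self p hn) (ZMod p)

theorem isUnit_iff_modP_ne_zero {p n : ℕ} [Fact p.Prime] (hn : n ≠ 0) (x : ZMod (p ^ n)) :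
    IsUnit x ↔ modP p hn x ≠ 0 := by
  obtain ⟨a, rfl⟩ := ZMod.intCast_surjective x
  rw [ZMod.coe_int_isUnit_iff_isCoprime, map_intCast, Ne, ZMod.intCast_zmod_eq_zero_iff_dvd]
  push_cast
  rw [IsCoprime.pow_left_iff (Nat.pos_of_ne_zero hn),
    (Nat.prime_iff_prime_int.1 (Fact.out : p.Prime)).coprime_iff_not_dvd]

theorem two_ne_zero_zmod {p : ℕ} [Fact p.Prime] (hp : 2 < p) : (2 : ZMod p) ≠ 0 := by
  have : ((2 : ℕ) : ZMod p) ≠ 0 := by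
    rw [Ne, ZMod.natCast_eq_zero_iff]
    exact fun h => absurd (Nat.le_of_dvd two_pos h) (by omega)
  exact_mod_cast this

/-- Square roots of units modulo an odd prime power are determined by their residue. -/
theorem eq_of_sq_eq_of_modP_eq {p n : ℕ} [Fact p.Prime] (hp : 2 < p) (hn : n ≠ 0)
    {z w : ZMod (p ^ n)} (hz : IsUnit z) (hzw : z ^ 2 = w ^ 2) (hred : modP p hn z = modP p hn w) :
    z = w := by
  have hu : IsUnit (z + w) := by
    rw [isUnit_iff_modP_ne_zero hn] at hz ⊢
    rw [map_add, ← hred, ← two_mul]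
    exact mul_ne_zero (two_ne_zero_zmod hp) hz
  have : (z + w) * (z - w) = (z + w) * 0 := by linear_combination hzw
  exact sub_eq_zero.1 (hu.mul_left_cancel this)

theorem pow_dvd_sub_of_pow_mul_eq_zero {p n k r : ℕ} [Fact p.Prime] {u : ℤ}
    (hu : IsCoprime u (p : ℤ)) {y y' : ZMod (p ^ n)}
    (h : (p : ZMod (p ^ n)) ^ k * ((p : ZMod (p ^ n)) ^ r * u * (y - y')) = 0) :
    (p : ℤ) ^ (n - k - r) ∣ (y.val : ℤ) - y'.val := by
  have hp : (p : ℤ) ≠ 0 := by exact_mod_cast (Fact.out : p.Prime).ne_zero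
  have h' : ((p ^ n : ℕ) : ℤ) ∣ (p : ℤ) ^ (k + r) * (u * ((y.val : ℤ) - y'.val)) := by
    rw [← ZMod.intCast_zmod_eq_zero_iff_dvd]
    push_cast
    rw [ZMod.natCast_zmod_val, ZMod.natCast_zmod_val]
    linear_combination h
  -- If n ≤ k + r, truncated subtraction makes the exponent 0 and nothing is claimed.
  rcases le_total n (k + r) with hc | hc
  · rw [show n - k - r = 0 by omega, pow_zero]
    exact one_dvd _
  · have hpow : ((p ^ n : ℕ) : ℤ) = (p : ℤ) ^ (k + r) * (p : ℤ) ^ (n - k - r) := by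
      rw [Nat.cast_pow, ← pow_add]
      congr 1
      omega
    rw [hpow] at h'
    have := (mul_dvd_mul_iff_left (pow_ne_zero (k + r) hp)).1 h'
    exact hu.symm.pow_left.dvd_of_dvd_mul_left this

/-- The first coordinate is free. It fixes the second modulo p^(n-k-r) through the stationarity
relation, and the equation then fixes the square of the third, a unit determined by its residue
modulo p. -/
theorem card_le_of_stationary {p n k r : ℕ} [Fact p.Prime] (hp : 2 < p) (hn : n ≠ 0)
    {α β γ h₁ h₂ : ℤ} (hβ : IsCoprime β (p : ℤ)) (hγ : IsCoprime γ (p : ℤ))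
    (hh : IsCoprime h₁ (p : ℤ)) (T : Finset (ZMod (p ^ n) × ZMod (p ^ n) × ZMod (p ^ n)))
    (hT : ∀ x ∈ T, IsUnit x.2.2 ∧
      (α : ZMod (p ^ n)) * x.1 ^ 2 + β * x.2.1 ^ 2 + γ * x.2.2 ^ 2 = 0 ∧
      (p : ZMod (p ^ n)) ^ k * (β * x.2.1 * ((p : ZMod (p ^ n)) ^ r * h₁) - α * x.1 * h₂) = 0) :
    T.card ≤ p ^ n * p ^ (k + r) * p := by
  have hp0 : 0 < p := by omega
  have hle : p ^ n * p ^ (n - (n - k - r)) * p ≤ p ^ n * p ^ (k + r) * p := by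
    have : n - (n - k - r) ≤ k + r := by omega
    gcongr
  refine le_trans ?_ hle
  have hcard : ((Finset.univ : Finset (ZMod (p ^ n))) ×ˢ
      (Finset.range (p ^ (n - (n - k - r))) ×ˢ (Finset.univ : Finset (ZMod p)))).card =
      p ^ n * p ^ (n - (n - k - r)) * p := by
    simp [ZMod.card, mul_assoc]
  rw [← hcard]
  refine Finset.card_le_card_of_injOn
    (fun x => (x.1, x.2.1.val / p ^ (n - k - r), modP p hn x.2.2)) ?_ ?_
  · intro x _
    simp only [Finset.coe_product, Finset.coe_univ, Finset.coe_range, Set.mem_prod, Set.mem_univ,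
      true_and, and_true, Set.mem_Iio]
    rw [Nat.div_lt_iff_lt_mul (pow_pos hp0 _), ← pow_add, Nat.sub_add_cancel (by omega)]
    exact ZMod.val_lt _
  · rintro ⟨x, y, z⟩ hx ⟨x', y', z'⟩ hx' heq
    obtain ⟨hz, hQ, hD⟩ := hT _ hx
    obtain ⟨hz', hQ', hD'⟩ := hT _ hx'
    simp only [Prod.mk.injEq] at *
    obtain ⟨rfl, hdiv, hred⟩ := heq
    have hy : y = y' := by
      have hd : (p : ℤ) ^ (n - k - r) ∣ (y.val : ℤ) - y'.val := by
        refine pow_dvd_sub_of_pow_mul_eq_zero (hβ.mul_left hh) ?_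
        push_cast
        linear_combination hD - hD'
      have hmod : y'.val % p ^ (n - k - r) = y.val % p ^ (n - k - r) := by
        rw [← Nat.cast_pow] at hd
        exact (Nat.modEq_iff_dvd (n := p ^ (n - k - r))).2 hd
      apply ZMod.val_injective
      rw [← Nat.div_add_mod y.val (p ^ (n - k - r)), ← Nat.div_add_mod y'.val (p ^ (n - k - r)),
        hdiv, hmod]
    subst hy
    refine ⟨rfl, rfl, eq_of_sq_eq_of_modP_eq hp hn hz ?_ hred⟩
    apply (isUnit_intCast_zmod_pow n hγ).mul_left_cancel
    linear_combination hQ - hQ'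

/-- The number of stationary points at a frequency `p ^ r • h` with `h` not divisible by `p`. -/
theorem card_stationarySet_le {p n k r : ℕ} [Fact p.Prime] (hp : 2 < p) (hn : n ≠ 0)
    {α₁ α₂ α₃ : ℤ}
    (h₁ : IsCoprime α₁ (p : ℤ)) (h₂ : IsCoprime α₂ (p : ℤ)) (h₃ : IsCoprime α₃ (p : ℤ))
    (a b c : ℤ) (habc : IsCoprime a (p : ℤ) ∨ IsCoprime b (p : ℤ) ∨ IsCoprime c (p : ℤ)) :
    (stationarySet p n k α₁ α₂ α₃ ((p : ZMod (p ^ n)) ^ r * a, (p : ZMod (p ^ n)) ^ r * b,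
      (p : ZMod (p ^ n)) ^ r * c)).card ≤ p ^ n * p ^ (k + r) * p := by
  rcases habc with ha | hb | hc
  · refine card_le_of_stationary (h₂ := (p : ℤ) ^ r * b) hp hn (α := α₁) h₂ h₃ ha _
      fun x hx => ?_
    obtain ⟨hS, -, h4, h5, h6⟩ := mem_stationarySet h₁ h₂ h₃ hx
    simp only [unitSolutions, Finset.mem_filter, Finset.mem_univ, true_and] at hS
    push_cast
    exact ⟨hS.1.2.2, hS.2, h4⟩
  · have hinj : Function.Injective (fun x : ZMod (p ^ n) × ZMod (p ^ n) × ZMod (p ^ n) =>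
        (x.2.1, x.1, x.2.2)) := by
      rintro ⟨x, y, z⟩ ⟨x', y', z'⟩ h
      simp only [Prod.mk.injEq] at h ⊢
      tauto
    rw [← Finset.card_image_of_injective _ hinj]
    refine card_le_of_stationary (h₂ := (p : ℤ) ^ r * a) hp hn (α := α₂) h₁ h₃ hb _
      fun x hx => ?_
    obtain ⟨x, hx', rfl⟩ := Finset.mem_image.1 hx
    obtain ⟨hS, -, h4, h5, h6⟩ := mem_stationarySet h₁ h₂ h₃ hx'
    simp only [unitSolutions, Finset.mem_filter, Finset.mem_univ, true_and] at hS
    push_cast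
    exact ⟨hS.1.2.2, by linear_combination hS.2, by linear_combination -h4⟩
  · have hinj : Function.Injective (fun x : ZMod (p ^ n) × ZMod (p ^ n) × ZMod (p ^ n) =>
        (x.2.2, x.2.1, x.1)) := by
      rintro ⟨x, y, z⟩ ⟨x', y', z'⟩ h
      simp only [Prod.mk.injEq] at h ⊢
      tauto
    rw [← Finset.card_image_of_injective _ hinj]
    refine card_le_of_stationary (h₂ := (p : ℤ) ^ r * b) hp hn (α := α₃) h₂ h₁ hc _
      fun x hx => ?_
    obtain ⟨x, hx', rfl⟩ := Finset.mem_image.1 hx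
    obtain ⟨hS, -, h4, h5, h6⟩ := mem_stationarySet h₁ h₂ h₃ hx'
    simp only [unitSolutions, Finset.mem_filter, Finset.mem_univ, true_and] at hS
    push_cast
    exact ⟨hS.1.1, by linear_combination hS.2, by linear_combination -h6⟩

/-! ### The number of unit solutions -/

/-- Hensel lifting of square roots of units. -/
theorem exists_sq_modEq_pow {p : ℕ} [Fact p.Prime] (hp : 2 < p) {a c ξ : ℤ}
    (ha : IsCoprime a (p : ℤ)) (hξ : IsCoprime ξ (p : ℤ)) (h : (p : ℤ) ∣ a * ξ ^ 2 + c) (m : ℕ) :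
    ∃ x : ℤ, (p : ℤ) ∣ x - ξ ∧ (p : ℤ) ^ (m + 1) ∣ a * x ^ 2 + c := by
  induction m with
  | zero => exact ⟨ξ, by simp, by simpa using h⟩
  | succ m ih =>
    obtain ⟨x, hx, d, hd⟩ := ih
    have hx' : IsCoprime x (p : ℤ) := by
      obtain ⟨e, he⟩ := hx
      rw [show x = ξ + p * e by linarith]
      exact IsCoprime.add_mul_left_left hξ e
    have h2 : IsCoprime (2 : ℤ) (p : ℤ) := by
      have := (Nat.coprime_primes Nat.prime_two (Fact.out : p.Prime)).2 (by omega)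
      exact_mod_cast Nat.isCoprime_iff_coprime.2 this
    obtain ⟨u, v, huv⟩ := (h2.mul_left ha).mul_left hx'
    -- A Newton step: u inverts the derivative 2ax modulo p.
    refine ⟨x + p ^ (m + 1) * (-(u * d)), ?_, ?_⟩
    · rw [show x + (p : ℤ) ^ (m + 1) * (-(u * d)) - ξ = (x - ξ) + p * (p ^ m * (-(u * d))) by ring]
      exact dvd_add hx (dvd_mul_right _ _)
    · refine ⟨v * d + a * (u * d) ^ 2 * p ^ m, ?_⟩
      have e1 : (p : ℤ) ^ (m + 1 + 1) = p ^ (m + 1) * p := pow_succ _ _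
      have e2 : (p : ℤ) ^ (m + 1) = p ^ m * p := pow_succ _ _
      linear_combination hd + (p : ℤ) ^ (m + 1) * d * huv * (-1) +
        (-(v * d + a * (u * d) ^ 2 * p ^ m)) * e1 + a * (u * d) ^ 2 * p ^ (m + 1) * e2

theorem card_fiber_modP {p n : ℕ} [Fact p.Prime] (hn : n ≠ 0) (ξ : ZMod p) :
    (Finset.univ.filter fun x : ZMod (p ^ n) => modP p hn x = ξ).card = p ^ (n - 1) := by
  have hsurj : Function.Surjective (modP p hn) := ZMod.castHom_surjective _
  have hconst : ∀ η : ZMod p, (Finset.univ.filter fun x : ZMod (p ^ n) => modP p hn x = η).card =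
      (Finset.univ.filter fun x : ZMod (p ^ n) => modP p hn x = ξ).card := by
    intro η
    obtain ⟨d, hd⟩ := hsurj (ξ - η)
    refine Finset.card_bij' (fun x _ => x + d) (fun x _ => x - d) ?_ ?_ ?_ ?_ <;> intro x hx <;>
      simp_all
  have htot : ∑ η : ZMod p, (Finset.univ.filter fun x : ZMod (p ^ n) => modP p hn x = η).card =
      p ^ n := by
    rw [← Finset.card_eq_sum_card_fiberwise (fun _ _ => Finset.mem_coe.2 (Finset.mem_univ _))]
    simp [ZMod.card]
  rw [Finset.sum_congr rfl fun η _ => hconst η, Finset.sum_const, Finset.card_univ, ZMod.card,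
    smul_eq_mul] at htot
  apply Nat.eq_of_mul_eq_mul_left (Fact.out : p.Prime).pos
  rw [htot, ← pow_succ', Nat.sub_add_cancel (Nat.pos_of_ne_zero hn)]

/-- Unit solutions modulo `p`, as a set of residues. -/
def residueSolutions (p : ℕ) [Fact p.Prime] (α₁ α₂ α₃ : ℤ) : Finset (ZMod p × ZMod p × ZMod p) :=
  Finset.univ.filter fun x => (x.1 ≠ 0 ∧ x.2.1 ≠ 0 ∧ x.2.2 ≠ 0) ∧
    (α₁ : ZMod p) * x.1 ^ 2 + α₂ * x.2.1 ^ 2 + α₃ * x.2.2 ^ 2 = 0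

/-- Above a residue solution, two coordinates lift arbitrarily and Hensel's lemma lifts the third
uniquely. -/
theorem card_unitSolutions_eq_mul {p n : ℕ} [Fact p.Prime] (hp : 2 < p) (hn : n ≠ 0)
    {α₁ α₂ α₃ : ℤ} (h₃ : IsCoprime α₃ (p : ℤ)) :
    (unitSolutions p n α₁ α₂ α₃).card =
      (residueSolutions p α₁ α₂ α₃).card * (p ^ (n - 1) * p ^ (n - 1)) := by
  set F : ZMod (p ^ n) × ZMod (p ^ n) × ZMod (p ^ n) → ZMod p × ZMod p × ZMod p :=
    fun x => (modP p hn x.1, modP p hn x.2.1, modP p hn x.2.2) with hF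
  have hmaps : ∀ x ∈ unitSolutions p n α₁ α₂ α₃, F x ∈ residueSolutions p α₁ α₂ α₃ := by
    intro x hx
    simp only [unitSolutions, residueSolutions, Finset.mem_filter, Finset.mem_univ, true_and,
      isUnit_iff_modP_ne_zero hn] at hx ⊢
    refine ⟨hx.1, ?_⟩
    have := congrArg (modP p hn) hx.2
    simpa using this
  rw [Finset.card_eq_sum_card_fiberwise (f := F) (t := residueSolutions p α₁ α₂ α₃) hmaps]
  rw [Finset.sum_const_nat (m := p ^ (n - 1) * p ^ (n - 1))]
  rintro ⟨ξ, η, ζ⟩ hx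
  simp only [residueSolutions, Finset.mem_filter, Finset.mem_univ, true_and] at hx
  obtain ⟨⟨hξ, hη, hζ⟩, hQ⟩ := hx
  have hprod := congrArg₂ (· * ·) (card_fiber_modP hn ξ) (card_fiber_modP hn η)
  rw [← hprod, ← Finset.card_product]
  refine Finset.card_bij (fun x _ => (x.1, x.2.1)) ?_ ?_ ?_
  · rintro ⟨x, y, z⟩ hx
    simp only [Finset.mem_filter, hF, Prod.mk.injEq] at hx
    simp only [Finset.mem_product, Finset.mem_filter, Finset.mem_univ, true_and]
    exact ⟨hx.2.1, hx.2.2.1⟩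
  · rintro ⟨x, y, z⟩ hx ⟨x', y', z'⟩ hx' heq
    simp only [Finset.mem_filter, hF, Prod.mk.injEq, unitSolutions, Finset.mem_univ,
      true_and] at hx hx' heq
    obtain ⟨rfl, rfl⟩ := heq
    simp only [Prod.mk.injEq, true_and]
    refine eq_of_sq_eq_of_modP_eq hp hn hx.1.1.2.2 ?_ (hx.2.2.2.trans hx'.2.2.2.symm)
    apply (isUnit_intCast_zmod_pow n h₃).mul_left_cancel
    linear_combination hx.1.2 - hx'.1.2
  · rintro ⟨x, y⟩ hxy
    simp only [Finset.mem_product, Finset.mem_filter, Finset.mem_univ, true_and] at hxy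
    obtain ⟨rfl, rfl⟩ := hxy
    obtain ⟨a, rfl⟩ := ZMod.intCast_surjective x
    obtain ⟨b, rfl⟩ := ZMod.intCast_surjective y
    obtain ⟨c, rfl⟩ := ZMod.intCast_surjective ζ
    rw [map_intCast, map_intCast] at *
    have hc : IsCoprime c (p : ℤ) := by
      rw [isCoprime_comm, (Nat.prime_iff_prime_int.1 (Fact.out : p.Prime)).coprime_iff_not_dvd,
        ← ZMod.intCast_zmod_eq_zero_iff_dvd]
      exact hζ
    obtain ⟨z, hz, hz2⟩ := exists_sq_modEq_pow hp (c := α₁ * a ^ 2 + α₂ * b ^ 2) h₃ hc (by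
      rw [← ZMod.intCast_zmod_eq_zero_iff_dvd]
      push_cast
      linear_combination hQ) (n - 1)
    have hz' : (z : ZMod p) = c := by
      rw [← ZMod.intCast_zmod_eq_zero_iff_dvd] at hz
      push_cast at hz
      exact sub_eq_zero.1 hz
    refine ⟨((a : ZMod (p ^ n)), (b : ZMod (p ^ n)), (z : ZMod (p ^ n))), ?_, rfl⟩
    simp only [Finset.mem_filter, hF, Prod.mk.injEq, unitSolutions, Finset.mem_univ,
      true_and, isUnit_iff_modP_ne_zero hn, map_intCast, hz', and_true]
    refine ⟨⟨hξ, hη, hζ⟩, ?_⟩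
    rw [Nat.sub_add_cancel (Nat.pos_of_ne_zero hn), ← Nat.cast_pow,
      ← ZMod.intCast_zmod_eq_zero_iff_dvd] at hz2
    push_cast at hz2
    linear_combination hz2

/-! ### Conics over a finite field, by Jacobi sums. -/

section FiniteField

variable {F : Type*} [Field F] [Fintype F] [DecidableEq F]

/-- This is the usual 1 + χ count of square roots. Requiring u ≠ 0 removes t = 0, which the trivial
character encodes, so that products of such counts sum to Jacobi sums. -/
theorem card_scaled_sq_eq (hF : ringChar F ≠ 2) {a c : F} (ha : a ≠ 0) (hc : c ≠ 0) (t : F) :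
    (((Finset.univ.filter fun u : F => u ≠ 0 ∧ a * u ^ 2 = c * t).card : ℕ) : ℤ) =
      (1 : MulChar F ℤ) t + quadraticChar F (a * c) * quadraticChar F t := by
  by_cases ht : t = 0
  · subst ht
    rw [Finset.filter_eq_empty_iff.2]
    · simp [MulChar.map_nonunit]
    · rintro u - ⟨hu, h⟩
      exact mul_ne_zero ha (pow_ne_zero 2 hu) (by simpa using h)
  · have hset : (Finset.univ.filter fun u : F => u ≠ 0 ∧ a * u ^ 2 = c * t) =
        {x : F | x ^ 2 = a * c * t / a ^ 2}.toFinset := by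
      ext u
      simp only [Finset.mem_filter, Finset.mem_univ, true_and, Set.mem_toFinset, Set.mem_ofPred_eq]
      constructor
      · rintro ⟨-, h⟩
        rw [eq_div_iff (pow_ne_zero 2 ha)]
        linear_combination a * h
      · intro h
        rw [eq_div_iff (pow_ne_zero 2 ha)] at h
        have h' : a * u ^ 2 = c * t := mul_left_cancel₀ ha (by linear_combination h)
        refine ⟨?_, h'⟩
        rintro rfl
        exact mul_ne_zero hc ht (by simpa using h'.symm)
    rw [hset, quadraticChar_card_sqrts hF, MulChar.one_apply (Ne.isUnit ht), ← map_mul]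
    have hdiv : quadraticChar F (a * c * t / a ^ 2) = quadraticChar F (a * c * t) := by
      have := quadraticChar_sq_one' ha
      have h2 : a * c * t = (a * c * t / a ^ 2) * a ^ 2 := by
        rw [div_mul_cancel₀ _ (pow_ne_zero 2 ha)]
      conv_rhs => rw [h2, map_mul, this, mul_one]
    rw [hdiv]
    ring

/-- The number of points with nonzero coordinates on the affine conic `a u² + b v² = c`. -/
theorem card_conic_units (hF : ringChar F ≠ 2) {a b c : F} (ha : a ≠ 0) (hb : b ≠ 0) (hc : c ≠ 0) :
    (((Finset.univ.filter fun x : F × F => (x.1 ≠ 0 ∧ x.2 ≠ 0) ∧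
      a * x.1 ^ 2 + b * x.2 ^ 2 = c).card : ℕ) : ℤ) =
      Fintype.card F - 2 - quadraticChar F (a * c) - quadraticChar F (b * c)
        - quadraticChar F (-(a * b)) := by
  have hχ : quadraticChar F ≠ 1 := quadraticChar_ne_one hF
  have hinv : (quadraticChar F)⁻¹ = quadraticChar F := (quadraticChar_isQuadratic F).inv
  -- Fibre by t with au² = ct and bv² = c(1 - t); the sum over t becomes four Jacobi sums.
  rw [Finset.card_eq_sum_card_fiberwise (f := fun x : F × F => a * x.1 ^ 2 / c)
    (t := Finset.univ) (fun _ _ => Finset.mem_coe.2 (Finset.mem_univ _))]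
  have hfib : ∀ t : F, (((Finset.univ.filter fun x : F × F => (x.1 ≠ 0 ∧ x.2 ≠ 0) ∧
      a * x.1 ^ 2 + b * x.2 ^ 2 = c).filter fun x => a * x.1 ^ 2 / c = t).card : ℤ) =
      ((1 : MulChar F ℤ) t + quadraticChar F (a * c) * quadraticChar F t) *
      ((1 : MulChar F ℤ) (1 - t) + quadraticChar F (b * c) * quadraticChar F (1 - t)) := by
    intro t
    rw [← card_scaled_sq_eq hF ha hc, ← card_scaled_sq_eq hF hb hc, ← Nat.cast_mul,
      ← Finset.card_product]
    congr 2
    ext ⟨u, v⟩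
    simp only [Finset.mem_filter, Finset.mem_univ, true_and, Finset.mem_product, div_eq_iff hc]
    constructor
    · rintro ⟨⟨⟨hu, hv⟩, h⟩, h'⟩
      exact ⟨⟨hu, by linear_combination h'⟩, hv, by linear_combination h - h'⟩
    · rintro ⟨⟨hu, h⟩, hv, h'⟩
      exact ⟨⟨⟨hu, hv⟩, by linear_combination h + h'⟩, by linear_combination h⟩
  push_cast
  rw [Finset.sum_congr rfl fun t _ => hfib t]
  have h11 : ∑ t : F, (1 : MulChar F ℤ) t * (1 : MulChar F ℤ) (1 - t) = Fintype.card F - 2 :=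
    jacobiSum_one_one
  have h1χ : ∑ t : F, (1 : MulChar F ℤ) t * quadraticChar F (1 - t) = -1 :=
    jacobiSum_one_nontrivial hχ
  have hχ1 : ∑ t : F, quadraticChar F t * (1 : MulChar F ℤ) (1 - t) = -1 := by
    have := jacobiSum_one_nontrivial hχ
    rw [jacobiSum_comm] at this
    exact this
  have hχχ : ∑ t : F, quadraticChar F t * quadraticChar F (1 - t) = -quadraticChar F (-1) := by
    have := jacobiSum_nontrivial_inv hχ
    rw [hinv] at this
    exact this
  have hsplit : ∀ t : F, ((1 : MulChar F ℤ) t + quadraticChar F (a * c) * quadraticChar F t) *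
      ((1 : MulChar F ℤ) (1 - t) + quadraticChar F (b * c) * quadraticChar F (1 - t)) =
      (1 : MulChar F ℤ) t * (1 : MulChar F ℤ) (1 - t) +
      quadraticChar F (b * c) * ((1 : MulChar F ℤ) t * quadraticChar F (1 - t)) +
      quadraticChar F (a * c) * (quadraticChar F t * (1 : MulChar F ℤ) (1 - t)) +
      quadraticChar F (a * c) * quadraticChar F (b * c) *
        (quadraticChar F t * quadraticChar F (1 - t)) := fun t => by ring
  simp only [hsplit, Finset.sum_add_distrib, ← Finset.mul_sum, h11, h1χ, hχ1, hχχ]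
  have hab : quadraticChar F (a * c) * quadraticChar F (b * c) * quadraticChar F (-1) =
      quadraticChar F (-(a * b)) := by
    have := quadraticChar_sq_one' hc
    rw [← map_mul, ← map_mul, show a * c * (b * c) * -1 = -(a * b) * c ^ 2 by ring, map_mul, this,
      mul_one]
  linear_combination -hab

end FiniteField

theorem intCast_zmod_ne_zero {p : ℕ} [Fact p.Prime] {a : ℤ} (ha : IsCoprime a (p : ℤ)) :
    (a : ZMod p) ≠ 0 := by
  rw [Ne, ZMod.intCast_zmod_eq_zero_iff_dvd,
    ← (Nat.prime_iff_prime_int.1 (Fact.out : p.Prime)).coprime_iff_not_dvd]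
  exact ha.symm

/-- By homogeneity, dividing by the third coordinate leaves p - 1 scalings of the affine conic α₁u²
+ α₂v² = -α₃. -/
theorem card_residueSolutions {p : ℕ} [Fact p.Prime] (hp : 2 < p) {α₁ α₂ α₃ : ℤ}
    (h₁ : IsCoprime α₁ (p : ℤ)) (h₂ : IsCoprime α₂ (p : ℤ)) (h₃ : IsCoprime α₃ (p : ℤ)) :
    ((residueSolutions p α₁ α₂ α₃).card : ℤ) = ((p : ℤ) - s p α₁ α₂ α₃) * ((p : ℤ) - 1) := by
  have hF : ringChar (ZMod p) ≠ 2 := by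
    rw [ZMod.ringChar_zmod_n]
    omega
  have hconic := card_conic_units hF (intCast_zmod_ne_zero h₁) (intCast_zmod_ne_zero h₂)
    (neg_ne_zero.2 (intCast_zmod_ne_zero h₃))
  set B := Finset.univ.filter fun x : ZMod p × ZMod p => (x.1 ≠ 0 ∧ x.2 ≠ 0) ∧
      (α₁ : ZMod p) * x.1 ^ 2 + α₂ * x.2 ^ 2 = -α₃ with hB
  have hcard : (residueSolutions p α₁ α₂ α₃).card =
      ((Finset.univ.filter fun w : ZMod p => w ≠ 0) ×ˢ B).card := by
    refine Finset.card_bij' (fun x _ => (x.2.2, x.1 / x.2.2, x.2.1 / x.2.2))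
      (fun x _ => (x.2.1 * x.1, x.2.2 * x.1, x.1)) ?_ ?_ ?_ ?_
    · rintro ⟨x, y, z⟩ hx
      simp only [residueSolutions, Finset.mem_filter, Finset.mem_univ, true_and,
        Finset.mem_product, hB] at hx ⊢
      obtain ⟨⟨hx, hy, hz⟩, hQ⟩ := hx
      refine ⟨hz, ⟨div_ne_zero hx hz, div_ne_zero hy hz⟩, ?_⟩
      field_simp
      linear_combination hQ
    · rintro ⟨w, u, v⟩ hx
      simp only [residueSolutions, Finset.mem_filter, Finset.mem_univ, true_and,
        Finset.mem_product, hB] at hx ⊢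
      obtain ⟨hw, ⟨hu, hv⟩, hQ⟩ := hx
      exact ⟨⟨mul_ne_zero hu hw, mul_ne_zero hv hw, hw⟩, by linear_combination w ^ 2 * hQ⟩
    · rintro ⟨x, y, z⟩ hx
      simp only [residueSolutions, Finset.mem_filter, Finset.mem_univ, true_and] at hx
      simp [div_mul_cancel₀ _ hx.1.2.2]
    · rintro ⟨w, u, v⟩ hx
      simp only [Finset.mem_filter, Finset.mem_univ, true_and, Finset.mem_product] at hx
      simp [mul_div_cancel_right₀ _ hx.1]
  have hw : (Finset.univ.filter fun w : ZMod p => w ≠ 0).card = p - 1 := by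
    rw [Finset.filter_ne', Finset.card_erase_of_mem (Finset.mem_univ _), Finset.card_univ,
      ZMod.card]
  rw [hcard, Finset.card_product, hw, Nat.cast_mul, hconic, Nat.cast_sub (by omega), ZMod.card, s,
    legendreSym, legendreSym, legendreSym]
  push_cast
  rw [mul_neg, mul_neg]
  ring

theorem card_unitSolutions {p n : ℕ} [Fact p.Prime] (hp : 2 < p) (hn : n ≠ 0) {α₁ α₂ α₃ : ℤ}
    (h₁ : IsCoprime α₁ (p : ℤ)) (h₂ : IsCoprime α₂ (p : ℤ)) (h₃ : IsCoprime α₃ (p : ℤ)) :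
    ((unitSolutions p n α₁ α₂ α₃).card : ℝ) = C p α₁ α₂ α₃ * ((p : ℝ) ^ n) ^ 2 := by
  have hres := congrArg (Int.cast : ℤ → ℝ) (card_residueSolutions hp h₁ h₂ h₃)
  push_cast at hres
  rw [card_unitSolutions_eq_mul hp hn h₃]
  push_cast
  rw [hres, C]
  obtain ⟨m, rfl⟩ := Nat.exists_eq_succ_of_ne_zero hn
  have hp0 : (p : ℝ) ≠ 0 := by exact_mod_cast (Fact.out : p.Prime).ne_zero
  simp only [Nat.succ_eq_add_one, Nat.add_sub_cancel]
  field_simp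
  ring

/-! ### Integer points of bounded height on a conic -/

/-- The greatest common divisor of an integer triple. -/
def content (h : ℤ × ℤ × ℤ) : ℕ := Int.gcd h.1 (Int.gcd h.2.1 h.2.2)

theorem content_dvd (h : ℤ × ℤ × ℤ) :
    (content h : ℤ) ∣ h.1 ∧ (content h : ℤ) ∣ h.2.1 ∧ (content h : ℤ) ∣ h.2.2 :=
  ⟨Int.gcd_dvd_left .., (Int.gcd_dvd_right ..).trans (Int.gcd_dvd_left ..),
    (Int.gcd_dvd_right ..).trans (Int.gcd_dvd_right ..)⟩

theorem dvd_content {d : ℤ} {h : ℤ × ℤ × ℤ} (h1 : d ∣ h.1) (h2 : d ∣ h.2.1) (h3 : d ∣ h.2.2) :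
    d ∣ content h :=
  Int.dvd_coe_gcd h1 (Int.dvd_coe_gcd h2 h3)

theorem dvd_of_dvd_mul_primitive {d e : ℤ} {h : ℤ × ℤ × ℤ} (hh : content h = 1)
    (h1 : d ∣ e * h.1) (h2 : d ∣ e * h.2.1) (h3 : d ∣ e * h.2.2) : d ∣ e := by
  have b1 := Int.gcd_eq_gcd_ab h.1 (Int.gcd h.2.1 h.2.2)
  have b2 := Int.gcd_eq_gcd_ab h.2.1 h.2.2
  rw [show Int.gcd h.1 (Int.gcd h.2.1 h.2.2) = 1 from hh, b2, Nat.cast_one] at b1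
  rw [← mul_one e, b1]
  ring_nf
  exact dvd_add (dvd_add (h1.mul_right _) ((h2.mul_right _).mul_right _))
    ((h3.mul_right _).mul_right _)

/-- Two primitive integer points of a nondegenerate conic that are orthogonal and have first
coordinates of the same sign coincide. -/
theorem eq_of_polar_eq_zero {a b c : ℤ} (ha : a ≠ 0) (hb : b ≠ 0) (hc : c ≠ 0)
    {h k : ℤ × ℤ × ℤ} (hh : content h = 1) (hk : content k = 1)
    (hQ : a * h.1 ^ 2 + b * h.2.1 ^ 2 + c * h.2.2 ^ 2 = 0)
    (kQ : a * k.1 ^ 2 + b * k.2.1 ^ 2 + c * k.2.2 ^ 2 = 0)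
    (hh1 : h.1 ≠ 0) (hk1 : k.1 ≠ 0) (hsign : 0 < h.1 ↔ 0 < k.1)
    (hB : a * h.1 * k.1 + b * h.2.1 * k.2.1 + c * h.2.2 * k.2.2 = 0) : h = k := by
  obtain ⟨x, y, z⟩ := h
  obtain ⟨x', y', z'⟩ := k
  simp only at *
  -- The two points span a totally isotropic subspace, which for a nondegenerate ternary form is at
  -- most a line. The elimination makes this explicit: the minors involving the first coordinate
  -- vanish.
  have e1 : b * y * (x' * y - x * y') + c * z * (x' * z - x * z') = 0 := by
    linear_combination x' * hQ - x * hB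
  have e2 : b * y' * (x' * y - x * y') + c * z' * (x' * z - x * z') = 0 := by
    linear_combination x' * hB - x * kQ
  have f2 : a * x' * (x' * y - x * y') = -(c * z' * (y * z' - z * y')) := by
    apply mul_left_cancel₀ hk1
    linear_combination (x' * y - x * y') * kQ - y' * e2
  have g2 : (b * c * (y * z' - z * y')) * (x' * y - x * y') = 0 := by
    linear_combination c * z' * e1 - c * z * e2
  have E2 : x' * y - x * y' = 0 := by
    have : (a * x' * b) * (x' * y - x * y') ^ 2 = 0 := by
      linear_combination (b * (x' * y - x * y')) * f2 - z' * g2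
    have hne : a * x' * b ≠ 0 := mul_ne_zero (mul_ne_zero ha hk1) hb
    exact pow_eq_zero_iff two_ne_zero |>.1 ((mul_eq_zero.1 this).resolve_left hne)
  have E3 : x' * z - x * z' = 0 := by
    have f3 : a * x' * (x' * z - x * z') = b * y' * (y * z' - z * y') := by
      apply mul_left_cancel₀ hk1
      linear_combination (x' * z - x * z') * kQ - z' * e2
    have g3 : (b * c * (y * z' - z * y')) * (x' * z - x * z') = 0 := by
      linear_combination b * y * e2 - b * y' * e1
    have : (a * x' * c) * (x' * z - x * z') ^ 2 = 0 := by
      linear_combination (c * (x' * z - x * z')) * f3 + y' * g3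
    have hne : a * x' * c ≠ 0 := mul_ne_zero (mul_ne_zero ha hk1) hc
    exact pow_eq_zero_iff two_ne_zero |>.1 ((mul_eq_zero.1 this).resolve_left hne)
  have d1 : x ∣ x' := dvd_of_dvd_mul_primitive hh ⟨x', by ring⟩ ⟨y', by linear_combination E2⟩
    ⟨z', by linear_combination E3⟩
  have d2 : x' ∣ x := dvd_of_dvd_mul_primitive hk ⟨x, by ring⟩ ⟨y, by linear_combination -E2⟩
    ⟨z, by linear_combination -E3⟩
  have hx : x = x' := by
    rcases Int.associated_iff.1 (associated_of_dvd_dvd d1 d2) with h | h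
    · exact h
    · exfalso
      omega
  subst hx
  simp only [Prod.mk.injEq, true_and]
  exact ⟨mul_left_cancel₀ hh1 (by linear_combination E2),
    mul_left_cancel₀ hh1 (by linear_combination E3)⟩

/-- The box of integer triples of height at most `X`. -/
def box (X : ℕ) : Finset (ℤ × ℤ × ℤ) :=
  Finset.Icc (-(X : ℤ)) X ×ˢ (Finset.Icc (-(X : ℤ)) X ×ˢ Finset.Icc (-(X : ℤ)) X)

theorem mem_box {X : ℕ} {h : ℤ × ℤ × ℤ} :
    h ∈ box X ↔ |h.1| ≤ X ∧ |h.2.1| ≤ X ∧ |h.2.2| ≤ X := by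
  simp [box, abs_le]

/-- Primitive integer points of height at most `X` on a diagonal conic. -/
def primitivePoints (a b c : ℤ) (X : ℕ) : Finset (ℤ × ℤ × ℤ) :=
  (box X).filter fun h => content h = 1 ∧ a * h.1 ^ 2 + b * h.2.1 ^ 2 + c * h.2.2 ^ 2 = 0

/-- Two points of the conic that agree projectively modulo `p ^ m` have polar form divisible
by `p ^ (2 * m)`. -/
theorem pow_dvd_polar {p m : ℕ} [Fact p.Prime] (hp : 2 < p) {a b c : ℤ}
    (hb : IsCoprime b (p : ℤ)) {h k : ℤ × ℤ × ℤ}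
    (hQ : a * h.1 ^ 2 + b * h.2.1 ^ 2 + c * h.2.2 ^ 2 = 0)
    (kQ : a * k.1 ^ 2 + b * k.2.1 ^ 2 + c * k.2.2 ^ 2 = 0)
    (hh1 : IsCoprime h.1 (p : ℤ)) (hk1 : IsCoprime k.1 (p : ℤ)) (hh2 : IsCoprime h.2.1 (p : ℤ))
    (h2 : (p : ℤ) ∣ k.1 * h.2.1 - h.1 * k.2.1)
    (h3 : (p : ℤ) ^ m ∣ k.1 * h.2.2 - h.1 * k.2.2) :
    (p : ℤ) ^ (2 * m) ∣ a * h.1 * k.1 + b * h.2.1 * k.2.1 + c * h.2.2 * k.2.2 := by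
  obtain ⟨x, y, z⟩ := h
  obtain ⟨x', y', z'⟩ := k
  simp only at *
  have htwo : IsCoprime (2 : ℤ) (p : ℤ) := by
    have := (Nat.coprime_primes Nat.prime_two (Fact.out : p.Prime)).2 (by omega)
    exact_mod_cast Nat.isCoprime_iff_coprime.2 this
  -- Modulo p this is 2bx'y, a unit; so divisibility by p^m passes from the (x, z) minor to the (x,
  -- y) minor.
  have hcop : IsCoprime (b * (x' * y + x * y')) (p : ℤ) := by
    refine hb.mul_left ?_
    obtain ⟨d, hd⟩ := h2
    rw [show x' * y + x * y' = 2 * x' * y + p * (-d) by linear_combination -hd]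
    exact IsCoprime.add_mul_left_left ((htwo.mul_left hk1).mul_left hh2) _
  have h2' : (p : ℤ) ^ m ∣ x' * y - x * y' := by
    refine (hcop.symm.pow_left (m := m)).dvd_of_dvd_mul_left ?_
    rw [show b * (x' * y + x * y') * (x' * y - x * y') =
      (x' * z - x * z') * (-(c * (x' * z + x * z'))) by
        linear_combination x' ^ 2 * hQ - x ^ 2 * kQ]
    exact h3.mul_right _
  obtain ⟨d, hd⟩ := h2'
  obtain ⟨e, he⟩ := h3
  -- On the conic, 2xx' times the polar form is -b and -c times the squares of the two minors.
  refine (((htwo.mul_left hh1).mul_left hk1).symm.pow_left (m := 2 * m)).dvd_of_dvd_mul_left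
    ⟨-(b * d ^ 2 + c * e ^ 2), ?_⟩
  have hpow : (p : ℤ) ^ (2 * m) = p ^ m * p ^ m := by rw [two_mul, pow_add]
  rw [hpow]
  linear_combination x' ^ 2 * hQ + x ^ 2 * kQ - b * (x' * y - x * y' + p ^ m * d) * hd -
    c * (x' * z - x * z' + p ^ m * e) * he

/-- Label h by h₃/h₁ modulo p^m, h₂/h₁ modulo p and the sign of h₁. Points with equal labels have
polar form divisible by p^(2m) but smaller than it, hence zero, and so they are equal. -/
theorem card_primitivePoints_filter_le {p m : ℕ} [Fact p.Prime] (hp : 2 < p) {a b c : ℤ}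
    (ha : IsCoprime a (p : ℤ)) (hb : IsCoprime b (p : ℤ)) (hc : IsCoprime c (p : ℤ))
    (T : Finset (ℤ × ℤ × ℤ))
    (hT : ∀ h ∈ T, content h = 1 ∧ a * h.1 ^ 2 + b * h.2.1 ^ 2 + c * h.2.2 ^ 2 = 0 ∧
      IsCoprime h.1 (p : ℤ) ∧ IsCoprime h.2.1 (p : ℤ))
    (hsmall : ∀ h ∈ T, ∀ k ∈ T,
      |a * h.1 * k.1 + b * h.2.1 * k.2.1 + c * h.2.2 * k.2.2| < (p : ℤ) ^ (2 * m)) :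
    T.card ≤ p ^ m * p * 2 := by
  have hp1 : ¬ IsUnit (p : ℤ) := (Nat.prime_iff_prime_int.1 (Fact.out : p.Prime)).not_isUnit
  have hne : ∀ {u : ℤ}, IsCoprime u (p : ℤ) → u ≠ 0 := by
    rintro u hu rfl
    exact hp1 (isCoprime_zero_left.1 hu)
  have hcard : ((Finset.univ : Finset (ZMod (p ^ m))) ×ˢ
      ((Finset.univ : Finset (ZMod p)) ×ˢ (Finset.univ : Finset Bool))).card = p ^ m * p * 2 := by
    simp [ZMod.card, mul_assoc]
  rw [← hcard]
  refine Finset.card_le_card_of_injOn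
    (fun h => ((h.2.2 : ZMod (p ^ m)) * (h.1 : ZMod (p ^ m))⁻¹,
      (h.2.1 : ZMod p) * (h.1 : ZMod p)⁻¹, decide (0 < h.1))) (fun _ _ => Finset.mem_coe.2 (by simp only [Finset.mem_product, Finset.mem_univ, and_self])) ?_
  intro h hh k hk heq
  obtain ⟨hprim, hQ, hh1, hh2⟩ := hT h hh
  obtain ⟨kprim, kQ, hk1, hk2⟩ := hT k hk
  simp only [Prod.mk.injEq, decide_eq_decide] at heq
  obtain ⟨e3, e2, hsign⟩ := heq
  have u1 := ZMod.mul_inv_of_unit _ (isUnit_intCast_zmod_pow m hh1)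
  have u2 := ZMod.mul_inv_of_unit _ (isUnit_intCast_zmod_pow m hk1)
  have v1 : (h.1 : ZMod p) * (h.1 : ZMod p)⁻¹ = 1 := mul_inv_cancel₀ (intCast_zmod_ne_zero hh1)
  have v2 : (k.1 : ZMod p) * (k.1 : ZMod p)⁻¹ = 1 := mul_inv_cancel₀ (intCast_zmod_ne_zero hk1)
  have h2 : (p : ℤ) ∣ k.1 * h.2.1 - h.1 * k.2.1 := by
    rw [← ZMod.intCast_zmod_eq_zero_iff_dvd]
    push_cast
    linear_combination (h.1 * k.1 : ZMod p) * e2 - (k.1 * h.2.1 : ZMod p) * v1 +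
      (h.1 * k.2.1 : ZMod p) * v2
  have h3 : (p : ℤ) ^ m ∣ k.1 * h.2.2 - h.1 * k.2.2 := by
    rw [← Nat.cast_pow, ← ZMod.intCast_zmod_eq_zero_iff_dvd]
    push_cast
    linear_combination (h.1 * k.1 : ZMod (p ^ m)) * e3 - (k.1 * h.2.2 : ZMod (p ^ m)) * u1 +
      (h.1 * k.2.2 : ZMod (p ^ m)) * u2
  exact eq_of_polar_eq_zero (hne ha) (hne hb) (hne hc) hprim kprim hQ kQ (hne hh1) (hne hk1) hsign
    (Int.eq_zero_of_abs_lt_dvd (pow_dvd_polar hp hb hQ kQ hh1 hk1 hh2 h2 h3) (hsmall h hh k hk))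

/-- At a primitive point of the conic at least two coordinates are prime to `p`. -/
theorem isCoprime_pair_of_primitive {p : ℕ} [Fact p.Prime] {a b c : ℤ}
    (ha : IsCoprime a (p : ℤ)) (hb : IsCoprime b (p : ℤ)) (hc : IsCoprime c (p : ℤ))
    {h : ℤ × ℤ × ℤ} (hh : content h = 1)
    (hQ : a * h.1 ^ 2 + b * h.2.1 ^ 2 + c * h.2.2 ^ 2 = 0) :
    (IsCoprime h.1 (p : ℤ) ∧ IsCoprime h.2.1 (p : ℤ)) ∨
      (IsCoprime h.1 (p : ℤ) ∧ IsCoprime h.2.2 (p : ℤ)) ∨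
      (IsCoprime h.2.1 (p : ℤ) ∧ IsCoprime h.2.2 (p : ℤ)) := by
  have hpp : Prime (p : ℤ) := Nat.prime_iff_prime_int.1 (Fact.out : p.Prime)
  have hcop : ∀ {u : ℤ}, IsCoprime u (p : ℤ) ↔ ¬ (p : ℤ) ∣ u := by
    intro u
    rw [isCoprime_comm, hpp.coprime_iff_not_dvd]
  have hdvd : ∀ {u v w x y z : ℤ}, IsCoprime w (p : ℤ) → u * x ^ 2 + v * y ^ 2 + w * z ^ 2 = 0 →
      (p : ℤ) ∣ x → (p : ℤ) ∣ y → (p : ℤ) ∣ z := by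
    intro u v w x y z hw hq hx hy
    have : (p : ℤ) ∣ w * z ^ 2 := by
      rw [show w * z ^ 2 = -(u * x * x + v * y * y) by linear_combination hq]
      exact (dvd_add (hx.mul_left _) (hy.mul_left _)).neg_right
    exact hpp.dvd_of_dvd_pow ((hpp.dvd_or_dvd this).resolve_left (hcop.1 hw))
  have hnot : ¬ ((p : ℤ) ∣ h.1 ∧ (p : ℤ) ∣ h.2.1 ∧ (p : ℤ) ∣ h.2.2) := by
    rintro ⟨d1, d2, d3⟩
    have := dvd_content d1 d2 d3
    rw [hh, Nat.cast_one] at this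
    exact hpp.not_isUnit (isUnit_of_dvd_one this)
  have d12 := hdvd (x := h.1) (y := h.2.1) (z := h.2.2) hc hQ
  have d13 := hdvd (x := h.1) (y := h.2.2) (z := h.2.1) hb (u := a) (v := c)
    (by linear_combination hQ)
  have d23 := hdvd (x := h.2.1) (y := h.2.2) (z := h.1) ha (u := b) (v := c)
    (by linear_combination hQ)
  rw [hcop, hcop, hcop]
  tauto

/-- Take p^m just above AX with A = |a| + |b| + |c|: polar forms are at most AX² < p^(2m), while p^m
≤ pAX. The factor 3 covers the choice of two coordinates prime to p. -/
theorem card_primitivePoints_le {p : ℕ} [Fact p.Prime] (hp : 2 < p) {a b c : ℤ}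
    (ha : IsCoprime a (p : ℤ)) (hb : IsCoprime b (p : ℤ)) (hc : IsCoprime c (p : ℤ)) :
    ∃ K : ℕ, ∀ X : ℕ, 1 ≤ X → (primitivePoints a b c X).card ≤ K * X := by
  have hpp : Prime (p : ℤ) := Nat.prime_iff_prime_int.1 (Fact.out : p.Prime)
  have hcop : ∀ {u : ℤ}, IsCoprime u (p : ℤ) ↔ ¬ (p : ℤ) ∣ u := by
    intro u
    rw [isCoprime_comm, hpp.coprime_iff_not_dvd]
  set A := a.natAbs + b.natAbs + c.natAbs with hA
  have hA1 : 1 ≤ A := by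
    have : a ≠ 0 := by
      rintro rfl
      exact hcop.1 ha (dvd_zero _)
    omega
  refine ⟨3 * (p * A * p * 2), fun X hX => ?_⟩
  set m := Nat.log p (A * X) + 1 with hm
  have hAX : A * X ≠ 0 := (Nat.mul_pos hA1 hX).ne'
  have hm1 : A * X < p ^ m := Nat.lt_pow_succ_log_self (by omega) _
  have hm2 : p ^ m ≤ p * (A * X) := by
    rw [hm, pow_succ']
    exact Nat.mul_le_mul_left _ (Nat.pow_log_le_self _ hAX)
  have hbound : ∀ h ∈ box X, ∀ k ∈ box X,
      |a * h.1 * k.1 + b * h.2.1 * k.2.1 + c * h.2.2 * k.2.2| < (p : ℤ) ^ (2 * m) := by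
    intro h hh k hk
    rw [mem_box] at hh hk
    have hm1' : (A : ℤ) * X < (p : ℤ) ^ m := by exact_mod_cast hm1
    have hA' : (A : ℤ) = |a| + |b| + |c| := by
      rw [hA]
      push_cast
      simp
    have hA1' : (1 : ℤ) ≤ A := by exact_mod_cast hA1
    have hX0 : (0 : ℤ) ≤ X := by positivity
    calc |a * h.1 * k.1 + b * h.2.1 * k.2.1 + c * h.2.2 * k.2.2|
        ≤ |a * h.1 * k.1| + |b * h.2.1 * k.2.1| + |c * h.2.2 * k.2.2| := abs_add_three _ _ _
      _ ≤ |a| * X * X + |b| * X * X + |c| * X * X := by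
          simp only [abs_mul]
          gcongr
          exacts [hh.1, hk.1, hh.2.1, hk.2.1, hh.2.2, hk.2.2]
      _ = A * (X * X) := by rw [hA']; ring
      _ ≤ A * (A * (X * X)) := by
          refine le_mul_of_one_le_left (by positivity) hA1'
      _ = (A * X) * (A * X) := by ring
      _ < (p : ℤ) ^ m * (p : ℤ) ^ m := by
          gcongr
      _ = (p : ℤ) ^ (2 * m) := by rw [← pow_add, two_mul]
  have hle : p ^ m * p * 2 ≤ p * A * p * 2 * X := by
    calc p ^ m * p * 2 ≤ (p * (A * X)) * p * 2 := by gcongr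
      _ = _ := by ring
  set P := primitivePoints a b c X with hP
  have hPmem : ∀ h ∈ P, h ∈ box X ∧ content h = 1 ∧
      a * h.1 ^ 2 + b * h.2.1 ^ 2 + c * h.2.2 ^ 2 = 0 := fun h hh => by
    simpa [hP, primitivePoints] using hh
  have c12 : (P.filter fun h => IsCoprime h.1 (p : ℤ) ∧ IsCoprime h.2.1 (p : ℤ)).card ≤
      p ^ m * p * 2 := by
    refine card_primitivePoints_filter_le (a := a) (b := b) (c := c) hp ha hb hc _ ?_ ?_
    · intro h hh
      rw [Finset.mem_filter] at hh
      obtain ⟨-, h1, h2⟩ := hPmem h hh.1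
      exact ⟨h1, h2, hh.2⟩
    · intro h hh k hk
      rw [Finset.mem_filter] at hh hk
      exact hbound h (hPmem h hh.1).1 k (hPmem k hk.1).1
  have c13 : (P.filter fun h => IsCoprime h.1 (p : ℤ) ∧ IsCoprime h.2.2 (p : ℤ)).card ≤
      p ^ m * p * 2 := by
    have hinj : Function.Injective (fun x : ℤ × ℤ × ℤ => (x.1, x.2.2, x.2.1)) := by
      rintro ⟨x, y, z⟩ ⟨x', y', z'⟩ h
      simp only [Prod.mk.injEq] at h ⊢
      tauto
    rw [← Finset.card_image_of_injective _ hinj]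
    refine card_primitivePoints_filter_le (a := a) (b := c) (c := b) hp ha hc hb _ ?_ ?_
    · intro h hh
      obtain ⟨x, hx, rfl⟩ := Finset.mem_image.1 hh
      rw [Finset.mem_filter] at hx
      obtain ⟨-, h1, h2⟩ := hPmem x hx.1
      refine ⟨?_, by linear_combination h2, hx.2⟩
      rw [← h1, content, content, Int.gcd_comm x.2.2]
    · intro h hh k hk
      obtain ⟨x, hx, rfl⟩ := Finset.mem_image.1 hh
      obtain ⟨y, hy, rfl⟩ := Finset.mem_image.1 hk
      rw [Finset.mem_filter] at hx hy
      rw [add_right_comm]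
      exact hbound x (hPmem x hx.1).1 y (hPmem y hy.1).1
  have c23 : (P.filter fun h => IsCoprime h.2.1 (p : ℤ) ∧ IsCoprime h.2.2 (p : ℤ)).card ≤
      p ^ m * p * 2 := by
    have hinj : Function.Injective (fun x : ℤ × ℤ × ℤ => (x.2.1, x.2.2, x.1)) := by
      rintro ⟨x, y, z⟩ ⟨x', y', z'⟩ h
      simp only [Prod.mk.injEq] at h ⊢
      tauto
    rw [← Finset.card_image_of_injective _ hinj]
    refine card_primitivePoints_filter_le (a := b) (b := c) (c := a) hp hb hc ha _ ?_ ?_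
    · intro h hh
      obtain ⟨x, hx, rfl⟩ := Finset.mem_image.1 hh
      rw [Finset.mem_filter] at hx
      obtain ⟨-, h1, h2⟩ := hPmem x hx.1
      refine ⟨?_, by linear_combination h2, hx.2⟩
      rw [← h1, content, content, Int.gcd_comm x.1, ← Int.gcd_assoc]
    · intro h hh k hk
      obtain ⟨x, hx, rfl⟩ := Finset.mem_image.1 hh
      obtain ⟨y, hy, rfl⟩ := Finset.mem_image.1 hk
      rw [Finset.mem_filter] at hx hy
      have := hbound x (hPmem x hx.1).1 y (hPmem y hy.1).1
      rwa [add_assoc, add_comm] at this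
  have hcover : P ⊆ (P.filter fun h => IsCoprime h.1 (p : ℤ) ∧ IsCoprime h.2.1 (p : ℤ)) ∪
      ((P.filter fun h => IsCoprime h.1 (p : ℤ) ∧ IsCoprime h.2.2 (p : ℤ)) ∪
      (P.filter fun h => IsCoprime h.2.1 (p : ℤ) ∧ IsCoprime h.2.2 (p : ℤ))) := by
    intro h hh
    obtain ⟨-, h1, h2⟩ := hPmem h hh
    simp only [Finset.mem_union, Finset.mem_filter, hh, true_and]
    exact isCoprime_pair_of_primitive ha hb hc h1 h2
  have hfin : P.card ≤ 3 * (p ^ m * p * 2) := by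
    refine (Finset.card_le_card hcover).trans ((Finset.card_union_le _ _).trans ?_)
    refine (Nat.add_le_add c12 ((Finset.card_union_le _ _).trans (Nat.add_le_add c13 c23))).trans ?_
    exact le_of_eq (by ring)
  calc P.card ≤ 3 * (p ^ m * p * 2) := hfin
    _ ≤ 3 * (p * A * p * 2 * X) := by gcongr
    _ = 3 * (p * A * p * 2) * X := by ring

/-- Nonzero integer points of height at most `X` on a diagonal conic. -/
def conicPoints (a b c : ℤ) (X : ℕ) : Finset (ℤ × ℤ × ℤ) :=
  (box X).filter fun h => h ≠ 0 ∧ a * h.1 ^ 2 + b * h.2.1 ^ 2 + c * h.2.2 ^ 2 = 0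

theorem content_pos {h : ℤ × ℤ × ℤ} (hh : h ≠ 0) : 0 < content h := by
  rw [Nat.pos_iff_ne_zero]
  intro h0
  obtain ⟨h1, h2, h3⟩ := content_dvd h
  rw [h0, Nat.cast_zero, zero_dvd_iff] at h1 h2 h3
  exact hh (Prod.ext h1 (Prod.ext h2 h3))

theorem content_le {X : ℕ} {h : ℤ × ℤ × ℤ} (hh : h ≠ 0) (hX : h ∈ box X) : content h ≤ X := by
  rw [mem_box] at hX
  obtain ⟨h1, h2, h3⟩ := content_dvd h
  have key : ∀ u : ℤ, u ≠ 0 → |u| ≤ X → (content h : ℤ) ∣ u → content h ≤ X := by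
    intro u hu huX hd
    have := Int.le_of_dvd (abs_pos.2 hu) ((dvd_abs _ _).2 hd)
    exact_mod_cast this.trans huX
  by_cases e1 : h.1 = 0
  · by_cases e2 : h.2.1 = 0
    · by_cases e3 : h.2.2 = 0
      · exact absurd (Prod.ext e1 (Prod.ext e2 e3)) hh
      · exact key _ e3 hX.2.2 h3
    · exact key _ e2 hX.2.1 h2
  · exact key _ e1 hX.1 h1

theorem content_mul (g : ℕ) (h : ℤ × ℤ × ℤ) :
    content ((g : ℤ) * h.1, (g : ℤ) * h.2.1, (g : ℤ) * h.2.2) = g * content h := by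
  simp only [content, Int.gcd_mul_left, Int.natAbs_natCast, Nat.cast_mul]

theorem exists_eq_content_mul {h : ℤ × ℤ × ℤ} (hh : h ≠ 0) :
    ∃ k : ℤ × ℤ × ℤ, content k = 1 ∧
      h = ((content h : ℤ) * k.1, (content h : ℤ) * k.2.1, (content h : ℤ) * k.2.2) := by
  obtain ⟨⟨x, hx⟩, ⟨y, hy⟩, ⟨z, hz⟩⟩ := content_dvd h
  have e : h = ((content h : ℤ) * x, (content h : ℤ) * y, (content h : ℤ) * z) :=
    Prod.ext hx (Prod.ext hy hz)
  refine ⟨(x, y, z), ?_, e⟩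
  have h2 := content_mul (content h) (x, y, z)
  rw [← e] at h2
  exact Nat.eq_of_mul_eq_mul_left (content_pos hh) (by rw [← h2, mul_one])

theorem card_filter_content_le {a b c : ℤ} {X g : ℕ} :
    ((conicPoints a b c X).filter fun h => content h = g).card ≤
      (primitivePoints a b c (X / g)).card := by
  have hsub : ((conicPoints a b c X).filter fun h => content h = g) ⊆
      (primitivePoints a b c (X / g)).image
        fun k => ((g : ℤ) * k.1, (g : ℤ) * k.2.1, (g : ℤ) * k.2.2) := by
    intro h hh
    simp only [Finset.mem_filter, conicPoints] at hh
    obtain ⟨⟨hbox, h0, hQ⟩, hg⟩ := hh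
    obtain ⟨k, hk, e⟩ := exists_eq_content_mul h0
    have hgpos : 0 < g := hg ▸ content_pos h0
    rw [hg] at e
    refine Finset.mem_image.2 ⟨k, ?_, e.symm⟩
    have hg0 : (g : ℤ) ≠ 0 := by exact_mod_cast hgpos.ne'
    have hle : ∀ u : ℤ, |(g : ℤ) * u| ≤ X → |u| ≤ ((X / g : ℕ) : ℤ) := by
      intro u hu
      rw [Int.abs_eq_natAbs, Nat.cast_le, Nat.le_div_iff_mul_le hgpos]
      rw [Int.abs_eq_natAbs, Nat.cast_le, Int.natAbs_mul, Int.natAbs_natCast, mul_comm] at hu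
      exact hu
    rw [e, mem_box] at hbox
    rw [e] at hQ
    rw [primitivePoints, Finset.mem_filter, mem_box]
    refine ⟨⟨hle _ hbox.1, hle _ hbox.2.1, hle _ hbox.2.2⟩, hk, ?_⟩
    apply mul_left_cancel₀ (pow_ne_zero 2 hg0)
    simp only at hQ
    linear_combination hQ
  exact (Finset.card_le_card hsub).trans Finset.card_image_le

/-- With g = p^v g' and g' prime to p, each term is 1/g'. The pairs (v, g') are distinct, so a
harmonic sum is repeated at most once for each v ≤ log_p X. -/
theorem sum_pow_padicValNat_div_le {p : ℕ} [Fact p.Prime] (X : ℕ) :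
    ∑ g ∈ Finset.Icc 1 X, (p : ℝ) ^ padicValNat p g / g ≤
      (Nat.log p X + 1) * (1 + Real.log X) := by
  have hp : p.Prime := Fact.out
  have hterm : ∀ g ∈ Finset.Icc 1 X, (p : ℝ) ^ padicValNat p g / g =
      ((g / p ^ padicValNat p g : ℕ) : ℝ)⁻¹ := by
    intro g hg
    have hg0 : g ≠ 0 := by
      have := (Finset.mem_Icc.1 hg).1
      omega
    rw [Nat.cast_div pow_padicValNat_dvd (by
      exact_mod_cast pow_ne_zero _ hp.ne_zero), inv_div]
    push_cast
    rfl
  rw [Finset.sum_congr rfl hterm]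
  set F : ℕ → ℕ × ℕ := fun g => (padicValNat p g, g / p ^ padicValNat p g) with hF
  have hinj : Function.Injective F := by
    intro g g' h
    simp only [hF, Prod.mk.injEq] at h
    rw [← Nat.mul_div_cancel' (pow_padicValNat_dvd (p := p) (n := g)),
      ← Nat.mul_div_cancel' (pow_padicValNat_dvd (p := p) (n := g')), h.2, h.1]
  calc ∑ g ∈ Finset.Icc 1 X, ((g / p ^ padicValNat p g : ℕ) : ℝ)⁻¹
      = ∑ x ∈ (Finset.Icc 1 X).image F, ((x.2 : ℕ) : ℝ)⁻¹ := by
        rw [Finset.sum_image (fun _ _ _ _ h => hinj h)]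
    _ ≤ ∑ x ∈ Finset.range (Nat.log p X + 1) ×ˢ Finset.Icc 1 X, ((x.2 : ℕ) : ℝ)⁻¹ := by
        refine Finset.sum_le_sum_of_subset_of_nonneg ?_ (fun _ _ _ => by positivity)
        intro x hx
        obtain ⟨g, hg, rfl⟩ := Finset.mem_image.1 hx
        rw [Finset.mem_Icc] at hg
        have hg0 : g ≠ 0 := by omega
        rw [Finset.mem_product, Finset.mem_range, Finset.mem_Icc]
        refine ⟨Nat.lt_succ_of_le ((padicValNat_le_nat_log g).trans (Nat.log_mono_right hg.2)), ?_,
          (Nat.div_le_self _ _).trans hg.2⟩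
        exact Nat.div_pos (Nat.le_of_dvd (by omega) pow_padicValNat_dvd) (pow_pos hp.pos _)
    _ = (Nat.log p X + 1) * ∑ g ∈ Finset.Icc 1 X, ((g : ℕ) : ℝ)⁻¹ := by
        rw [Finset.sum_product]
        simp
    _ ≤ (Nat.log p X + 1) * (1 + Real.log X) := by
        gcongr
        have := harmonic_le_one_add_log X
        rw [harmonic_eq_sum_Icc] at this
        push_cast at this
        exact this

/-- Points of bounded height on a conic, weighted by the power of `p` in their content. -/
theorem sum_conicPoints_le {p : ℕ} [Fact p.Prime] (hp : 2 < p) {a b c : ℤ}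
    (ha : IsCoprime a (p : ℤ)) (hb : IsCoprime b (p : ℤ)) (hc : IsCoprime c (p : ℤ)) :
    ∃ K : ℕ, ∀ X : ℕ, ∑ h ∈ conicPoints a b c X, (p : ℝ) ^ padicValNat p (content h) ≤
      K * X * ((Nat.log p X + 1) * (1 + Real.log X)) := by
  obtain ⟨K, hK⟩ := card_primitivePoints_le hp ha hb hc
  refine ⟨K, fun X => ?_⟩
  have hmaps : ∀ h ∈ conicPoints a b c X, content h ∈ Finset.Icc 1 X := by
    intro h hh
    rw [conicPoints, Finset.mem_filter] at hh
    exact Finset.mem_Icc.2 ⟨content_pos hh.2.1, content_le hh.2.1 hh.1⟩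
  -- Points of content g are g times primitive points of height at most X/g, hence at most KX/g in
  -- number.
  rw [← Finset.sum_fiberwise_of_maps_to hmaps]
  calc ∑ g ∈ Finset.Icc 1 X, ∑ h ∈ (conicPoints a b c X).filter (fun h => content h = g),
        (p : ℝ) ^ padicValNat p (content h)
      ≤ ∑ g ∈ Finset.Icc 1 X, K * X * ((p : ℝ) ^ padicValNat p g / g) := by
        refine Finset.sum_le_sum fun g hg => ?_
        rw [Finset.mem_Icc] at hg
        rw [Finset.sum_congr rfl (g := fun _ => (p : ℝ) ^ padicValNat p g)
          (fun h hh => by rw [(Finset.mem_filter.1 hh).2]), Finset.sum_const, nsmul_eq_mul]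
        have h1 : (((conicPoints a b c X).filter fun h => content h = g).card : ℝ) ≤
            K * ((X / g : ℕ) : ℝ) := by
          exact_mod_cast card_filter_content_le.trans (hK _ (Nat.div_pos hg.2 hg.1))
        calc _ ≤ (K * ((X / g : ℕ) : ℝ)) * (p : ℝ) ^ padicValNat p g := by gcongr
          _ ≤ (K * ((X : ℝ) / g)) * (p : ℝ) ^ padicValNat p g := by
              gcongr
              exact Nat.cast_div_le
          _ = _ := by ring
    _ ≤ _ := by
        rw [← Finset.mul_sum]
        gcongr
        exact sum_pow_padicValNat_div_le X

/-! ### Exponential sums at nonzero integer frequencies. -/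

/-- The exponential sum at frequency `h` over the unit solutions modulo `p ^ n`. -/
def expSum (p n : ℕ) [NeZero (p ^ n)] (α₁ α₂ α₃ : ℤ) (h : ℤ × ℤ × ℤ) : ℂ :=
  ∑ x ∈ unitSolutions p n α₁ α₂ α₃,
    ZMod.stdAddChar (linForm ((h.1 : ZMod (p ^ n)), (h.2.1 : ZMod (p ^ n)),
      (h.2.2 : ZMod (p ^ n))) x)

theorem norm_sum_addChar_le_card {p n : ℕ} [NeZero (p ^ n)] {X : Type*} (S : Finset X)
    (f : X → ZMod (p ^ n)) : ‖∑ x ∈ S, (ZMod.stdAddChar (f x) : ℂ)‖ ≤ S.card := by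
  refine (norm_sum_le _ _).trans ?_
  simp [AddChar.norm_apply]

theorem norm_expSum_le_cube {p n : ℕ} [NeZero (p ^ n)] (α₁ α₂ α₃ : ℤ) (h : ℤ × ℤ × ℤ) :
    ‖expSum p n α₁ α₂ α₃ h‖ ≤ ((p : ℝ) ^ n) ^ 3 := by
  refine (norm_sum_addChar_le_card _ _).trans ?_
  have : (unitSolutions p n α₁ α₂ α₃).card ≤ (p ^ n) ^ 3 := by
    refine (Finset.card_le_univ _).trans (le_of_eq ?_)
    simp only [Fintype.card_prod, ZMod.card]
    ring
  exact_mod_cast this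

theorem exists_eq_pow_mul_coprime {p : ℕ} [Fact p.Prime] {h : ℤ × ℤ × ℤ} (hh : h ≠ 0) :
    ∃ a b c : ℤ, (IsCoprime a (p : ℤ) ∨ IsCoprime b (p : ℤ) ∨ IsCoprime c (p : ℤ)) ∧
      h = ((p : ℤ) ^ padicValNat p (content h) * a, (p : ℤ) ^ padicValNat p (content h) * b,
        (p : ℤ) ^ padicValNat p (content h) * c) := by
  have hpp : Prime (p : ℤ) := Nat.prime_iff_prime_int.1 (Fact.out : p.Prime)
  have hcop : ∀ {u : ℤ}, IsCoprime u (p : ℤ) ↔ ¬ (p : ℤ) ∣ u := by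
    intro u
    rw [isCoprime_comm, hpp.coprime_iff_not_dvd]
  obtain ⟨k, hk, e⟩ := exists_eq_content_mul hh
  obtain ⟨m, hm⟩ := pow_padicValNat_dvd (p := p) (n := content h)
  have hpm : ¬ (p : ℤ) ∣ m := by
    intro hd
    have hd' : p ∣ m := by exact_mod_cast hd
    obtain ⟨m', rfl⟩ := hd'
    refine pow_succ_padicValNat_not_dvd (p := p) (content_pos hh).ne' ⟨m', ?_⟩
    rw [pow_succ, mul_assoc]
    exact hm
  have hm' : (content h : ℤ) = (p : ℤ) ^ padicValNat p (content h) * m := by exact_mod_cast hm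
  refine ⟨m * k.1, m * k.2.1, m * k.2.2, ?_, ?_⟩
  · by_contra hcon
    rw [hcop, hcop, hcop] at hcon
    push Not at hcon
    obtain ⟨d1, d2, d3⟩ := hcon
    have := dvd_content ((hpp.dvd_or_dvd d1).resolve_left hpm)
      ((hpp.dvd_or_dvd d2).resolve_left hpm) ((hpp.dvd_or_dvd d3).resolve_left hpm)
    rw [hk, Nat.cast_one] at this
    exact hpp.not_isUnit (isUnit_of_dvd_one this)
  · rw [← mul_assoc, ← mul_assoc, ← mul_assoc, ← hm']
    exact e

theorem norm_expSum_le {p n : ℕ} [Fact p.Prime] (hp : 2 < p) (hn : n ≠ 0) {α₁ α₂ α₃ : ℤ}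
    (h₁ : IsCoprime α₁ (p : ℤ)) (h₂ : IsCoprime α₂ (p : ℤ)) (h₃ : IsCoprime α₃ (p : ℤ))
    {h : ℤ × ℤ × ℤ} (hh : h ≠ 0) :
    ‖expSum p n α₁ α₂ α₃ h‖ ≤
      (p : ℝ) ^ (n + (n + 1) / 2 + 1) * (p : ℝ) ^ padicValNat p (content h) := by
  obtain ⟨a, b, c, habc, e⟩ := exists_eq_pow_mul_coprime (p := p) hh
  set r := padicValNat p (content h)
  -- The least k with n ≤ 2k, which makes the bound p^(n+k+r+1) on stationary points smallest.
  rw [expSum, sum_addChar_unitSolutions (k := (n + 1) / 2) (by omega) (by omega) α₁ α₂ α₃ _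
    (ZMod.isPrimitive_stdAddChar _)]
  refine (norm_sum_addChar_le_card _ _).trans ?_
  have := card_stationarySet_le (r := r) (k := (n + 1) / 2) hp hn h₁ h₂ h₃ a b c habc
  rw [e]
  push_cast
  have h2 : p ^ n * p ^ ((n + 1) / 2 + r) * p = p ^ (n + (n + 1) / 2 + 1) * p ^ r := by ring
  rw [h2] at this
  exact_mod_cast this

/-- A nonzero sum has a stationary point, which forces a congruence modulo p^n; `hsmall` turns it
into an equality of integers. -/
theorem dualForm_eq_zero_of_expSum_ne_zero {p n : ℕ} [Fact p.Prime] (hn : n ≠ 0)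
    {α₁ α₂ α₃ : ℤ}
    (h₁ : IsCoprime α₁ (p : ℤ)) (h₂ : IsCoprime α₂ (p : ℤ)) (h₃ : IsCoprime α₃ (p : ℤ))
    {h : ℤ × ℤ × ℤ} (hG : expSum p n α₁ α₂ α₃ h ≠ 0)
    (hsmall : |(p : ℤ) * (α₂ * α₃ * h.1 ^ 2 + α₁ * α₃ * h.2.1 ^ 2 + α₁ * α₂ * h.2.2 ^ 2)| <
      (p : ℤ) ^ n) :
    α₂ * α₃ * h.1 ^ 2 + α₁ * α₃ * h.2.1 ^ 2 + α₁ * α₂ * h.2.2 ^ 2 = 0 := by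
  rw [expSum, sum_addChar_unitSolutions (k := (n + 1) / 2) (by omega) (by omega) α₁ α₂ α₃ _
    (ZMod.isPrimitive_stdAddChar _)] at hG
  obtain ⟨x, hx, -⟩ := Finset.exists_ne_zero_of_sum_ne_zero hG
  have := dualForm_eq_zero_of_mem_stationarySet (by omega) (by omega) h₁ h₂ h₃ hx
  have hd : ((p ^ n : ℕ) : ℤ) ∣
      (p : ℤ) * (α₂ * α₃ * h.1 ^ 2 + α₁ * α₃ * h.2.1 ^ 2 + α₁ * α₂ * h.2.2 ^ 2) := by
    rw [← ZMod.intCast_zmod_eq_zero_iff_dvd]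
    push_cast
    exact this
  rw [Nat.cast_pow] at hd
  have h0 := Int.eq_zero_of_abs_lt_dvd hd hsmall
  exact (mul_eq_zero.1 h0).resolve_left (by exact_mod_cast (Fact.out : p.Prime).ne_zero)

/-- The total size of the exponential sums at nonzero frequencies of height at most `X`. -/
theorem sum_norm_expSum_le {p : ℕ} [Fact p.Prime] (hp : 2 < p) {α₁ α₂ α₃ : ℤ}
    (h₁ : IsCoprime α₁ (p : ℤ)) (h₂ : IsCoprime α₂ (p : ℤ)) (h₃ : IsCoprime α₃ (p : ℤ)) :
    ∃ K : ℕ, ∀ n : ℕ, n ≠ 0 → ∀ X : ℕ,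
      (p : ℤ) * (|α₂ * α₃| + |α₁ * α₃| + |α₁ * α₂|) * (X : ℤ) ^ 2 < (p : ℤ) ^ n →
      ∑ h ∈ (box X).filter (fun h => h ≠ 0), ‖expSum p n α₁ α₂ α₃ h‖ ≤
        (p : ℝ) ^ (n + (n + 1) / 2 + 1) * (K * X * ((Nat.log p X + 1) * (1 + Real.log X))) := by
  obtain ⟨K, hK⟩ := sum_conicPoints_le hp (h₂.mul_left h₃) (h₁.mul_left h₃) (h₁.mul_left h₂)
  refine ⟨K, fun n hn X hX => ?_⟩
  have hsmall : ∀ h ∈ box X,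
      |(p : ℤ) * (α₂ * α₃ * h.1 ^ 2 + α₁ * α₃ * h.2.1 ^ 2 + α₁ * α₂ * h.2.2 ^ 2)| < (p : ℤ) ^ n := by
    intro h hh
    rw [mem_box] at hh
    refine lt_of_le_of_lt ?_ hX
    rw [abs_mul, Nat.abs_cast, mul_assoc (p : ℤ) (|α₂ * α₃| + |α₁ * α₃| + |α₁ * α₂|)]
    refine mul_le_mul_of_nonneg_left ?_ (by positivity)
    calc |α₂ * α₃ * h.1 ^ 2 + α₁ * α₃ * h.2.1 ^ 2 + α₁ * α₂ * h.2.2 ^ 2|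
        ≤ |α₂ * α₃ * h.1 ^ 2| + |α₁ * α₃ * h.2.1 ^ 2| + |α₁ * α₂ * h.2.2 ^ 2| := abs_add_three _ _ _
      _ = |α₂ * α₃| * |h.1| ^ 2 + |α₁ * α₃| * |h.2.1| ^ 2 + |α₁ * α₂| * |h.2.2| ^ 2 := by
          rw [abs_mul _ (h.1 ^ 2), abs_mul _ (h.2.1 ^ 2), abs_mul _ (h.2.2 ^ 2), abs_pow, abs_pow,
            abs_pow]
      _ ≤ |α₂ * α₃| * X ^ 2 + |α₁ * α₃| * X ^ 2 + |α₁ * α₂| * X ^ 2 := by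
          gcongr
          exacts [hh.1, hh.2.1, hh.2.2]
      _ = _ := by ring
  calc ∑ h ∈ (box X).filter (fun h => h ≠ 0), ‖expSum p n α₁ α₂ α₃ h‖
      = ∑ h ∈ conicPoints (α₂ * α₃) (α₁ * α₃) (α₁ * α₂) X, ‖expSum p n α₁ α₂ α₃ h‖ := by
        symm
        refine Finset.sum_subset ?_ ?_
        · intro h hh
          rw [conicPoints, Finset.mem_filter] at hh
          exact Finset.mem_filter.2 ⟨hh.1, hh.2.1⟩
        · intro h hh hh'
          rw [Finset.mem_filter] at hh
          rw [conicPoints, Finset.mem_filter] at hh'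
          by_contra hne
          exact hh' ⟨hh.1, hh.2, dualForm_eq_zero_of_expSum_ne_zero hn h₁ h₂ h₃
            (norm_ne_zero_iff.1 hne) (hsmall h hh.1)⟩
    _ ≤ ∑ h ∈ conicPoints (α₂ * α₃) (α₁ * α₃) (α₁ * α₂) X,
          (p : ℝ) ^ (n + (n + 1) / 2 + 1) * (p : ℝ) ^ padicValNat p (content h) := by
        refine Finset.sum_le_sum fun h hh => ?_
        rw [conicPoints, Finset.mem_filter] at hh
        exact norm_expSum_le hp hn h₁ h₂ h₃ hh.2.1
    _ ≤ _ := by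
        rw [← Finset.mul_sum]
        gcongr
        exact hK X

/-! ### Poisson summation in residue classes -/

/-- Polynomial decay of a Schwartz function. -/
theorem exists_norm_le_one_add_abs_pow (Ψ : 𝓢(ℝ, ℂ)) (k : ℕ) :
    ∃ D : ℝ, 0 ≤ D ∧ ∀ x, ‖Ψ x‖ ≤ D * ((1 + |x|) ^ k)⁻¹ := by
  refine ⟨2 ^ k * (Finset.Iic (k, 0)).sup (fun m => SchwartzMap.seminorm ℝ m.1 m.2) Ψ,
    by positivity, fun x => ?_⟩
  have := SchwartzMap.one_add_le_sup_seminorm_apply (𝕜 := ℝ) (m := (k, 0)) le_rfl le_rfl Ψ x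
  rw [norm_iteratedFDeriv_zero, Real.norm_eq_abs] at this
  rw [← div_eq_mul_inv, le_div_iff₀ (by positivity), mul_comm]
  exact this

theorem summable_inv_one_add_abs_sq : Summable fun m : ℤ => ((1 + |(m : ℝ)|) ^ 2)⁻¹ := by
  have h : Summable fun n : ℕ => ((1 + (n : ℝ)) ^ 2)⁻¹ := by
    have := (summable_nat_add_iff 1).2 (Real.summable_nat_pow_inv (p := 2) |>.2 (by norm_num))
    refine this.congr fun n => ?_
    push_cast
    rw [add_comm]
  refine Summable.of_nat_of_neg ?_ ?_ <;> simpa using h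

/-- The decay rate `(1 + |m| y)⁻ᵏ` dominates a fixed multiple of `(1 + |m|)⁻²`. -/
theorem inv_one_add_mul_sq_le {q y : ℝ} (hq : 1 ≤ q) (hy : 1 / q ≤ y) (m : ℝ) :
    ((1 + |m * y|) ^ 2)⁻¹ ≤ q ^ 2 * ((1 + |m|) ^ 2)⁻¹ := by
  have hq0 : 0 < q := by linarith
  have hy0 : 0 < y := lt_of_lt_of_le (by positivity) hy
  have h1 : 1 ≤ q * y := by
    rw [div_le_iff₀ hq0] at hy
    linarith
  have h2 : 1 + |m| ≤ q * (1 + |m * y|) := by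
    rw [abs_mul, abs_of_pos hy0]
    nlinarith [abs_nonneg m]
  rw [← div_eq_mul_inv, inv_eq_one_div, div_le_div_iff₀ (by positivity) (by positivity), one_mul,
    ← mul_pow]
  gcongr

theorem summable_norm_schwartz_int (Ψ : 𝓢(ℝ, ℂ)) {y : ℝ} (hy : 0 < y) :
    Summable fun m : ℤ => ‖Ψ (m * y)‖ := by
  obtain ⟨D, hD, hΨ⟩ := exists_norm_le_one_add_abs_pow Ψ 2
  set q := max 1 (1 / y)
  have hq : 1 ≤ q := le_max_left _ _
  have hqy : 1 / q ≤ y := by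
    rw [div_le_iff₀ (by linarith), mul_comm, ← div_le_iff₀ hy]
    exact le_max_right _ _
  refine Summable.of_nonneg_of_le (fun _ => norm_nonneg _) (fun m => ?_)
    ((summable_inv_one_add_abs_sq.mul_left (q ^ 2)).mul_left D)
  exact (hΨ _).trans (mul_le_mul_of_nonneg_left (inv_one_add_mul_sq_le hq hqy m) hD)

/-- The complexification of a real Schwartz function. -/
def complexify (Φ : 𝓢(ℝ, ℝ)) : 𝓢(ℝ, ℂ) := SchwartzMap.postcompCLM (𝕜 := ℝ) Complex.ofRealCLM Φ

theorem complexify_apply (Φ : 𝓢(ℝ, ℝ)) (x : ℝ) : complexify Φ x = (Φ x : ℂ) := rfl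

theorem fourier_complexify_zero (Φ : 𝓢(ℝ, ℝ)) : 𝓕 (complexify Φ) 0 = (fourierZero Φ : ℂ) := by
  rw [ofReal_fourierZero, SchwartzMap.fourier_coe]
  rfl

theorem fourierZero_eq_integral (Φ : 𝓢(ℝ, ℝ)) : fourierZero Φ = ∫ x, Φ x := by
  have h : 𝓕 (fun x : ℝ => (Φ x : ℂ)) 0 = ((∫ x, Φ x : ℝ) : ℂ) := by
    rw [Real.fourier_eq']
    simp [integral_complex_ofReal]
  rw [fourierZero, h, Complex.ofReal_re]

/-- Dilation of a Schwartz function. -/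
def dilate (c : ℝˣ) (f : 𝓢(ℝ, ℂ)) : 𝓢(ℝ, ℂ) :=
  SchwartzMap.compCLMOfContinuousLinearEquiv ℂ (ContinuousLinearEquiv.unitsEquivAut ℝ c) f

theorem dilate_apply (c : ℝˣ) (f : 𝓢(ℝ, ℂ)) (x : ℝ) : dilate c f x = f (x * c) := rfl

theorem fourier_dilate {c : ℝˣ} (hc : 0 < (c : ℝ)) (f : 𝓢(ℝ, ℂ)) (ξ : ℝ) :
    𝓕 (dilate c f) ξ = ((c : ℝ)⁻¹ : ℝ) * 𝓕 f (ξ * (c : ℝ)⁻¹) := by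
  rw [SchwartzMap.fourier_coe, SchwartzMap.fourier_coe, Real.fourier_eq', Real.fourier_eq']
  have := MeasureTheory.Measure.integral_comp_mul_right
    (fun v : ℝ => Complex.exp (↑(-2 * Real.pi * inner ℝ v (ξ * (c : ℝ)⁻¹)) * Complex.I) • f v)
    (c : ℝ)
  rw [abs_of_pos (inv_pos.2 hc), Complex.real_smul] at this
  rw [← this]
  congr 1
  ext v
  rw [dilate_apply]
  congr 5
  simp only [RCLike.inner_apply, conj_trivial]
  field_simp

/-- Poisson summation in a residue class modulo `q`. -/
theorem tsum_residue_class (Φ : 𝓢(ℝ, ℝ)) {q : ℕ} [NeZero q] {N : ℝ} (hN : 0 < N) (c : ZMod q) :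
    ∑' x : ℤ, (if (x : ZMod q) = c then (Φ (x / N) : ℂ) else 0) =
      (N / q : ℝ) * ∑' h : ℤ, 𝓕 (complexify Φ) (h * (N / q)) * ZMod.stdAddChar ((h : ZMod q) * c) := by
  have hq : (0 : ℝ) < q := by exact_mod_cast Nat.pos_of_ne_zero (NeZero.ne q)
  obtain ⟨a, rfl⟩ := ZMod.intCast_surjective c
  set g : ℤ → ℤ := fun m => a + q * m with hg
  have hginj : Function.Injective g := by
    intro m m' h
    have hq' : (q : ℤ) ≠ 0 := by exact_mod_cast NeZero.ne q
    exact mul_left_cancel₀ hq' (add_left_cancel h)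
  have hgx : ∀ m, ((g m : ℤ) : ZMod q) = (a : ZMod q) := by
    intro m
    simp [hg]
  rw [← hginj.tsum_eq]
  · simp only [hgx, if_true]
    set u : ℝˣ := Units.mk0 (q / N) (div_pos hq hN).ne' with hu
    have huv : (u : ℝ) = q / N := rfl
    -- Writing x = a + qm, the shift a/q reappears on the Fourier side as the phase e(ha/q).
    have hpois := SchwartzMap.tsum_eq_tsum_fourier (dilate u (complexify Φ)) (a / q)
    have hl : ∀ m : ℤ, (Φ (g m / N) : ℂ) = dilate u (complexify Φ) (a / q + m) := by
      intro m
      rw [dilate_apply, complexify_apply, huv, hg]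
      congr 2
      push_cast
      field_simp
    rw [tsum_congr hl, hpois, ← tsum_mul_left]
    refine tsum_congr fun h => ?_
    rw [fourier_dilate (by rw [huv]; positivity), huv, inv_div, fourier_coe_apply, mul_assoc]
    congr 2
    rw [← Int.cast_mul, ZMod.stdAddChar_coe]
    congr 1
    push_cast
    field_simp
  · intro x hx
    rw [Function.mem_support, Ne, ite_eq_right_iff, Classical.not_imp] at hx
    obtain ⟨m, hm⟩ := (ZMod.intCast_eq_intCast_iff_dvd_sub a x q).1 hx.1.symm
    exact ⟨m, by simp only [hg]; linarith⟩

theorem summable_schwartz_div (Φ : 𝓢(ℝ, ℝ)) {N : ℝ} (hN : 0 < N) :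
    Summable fun x : ℤ => ‖Φ (x / N)‖ := by
  have := summable_norm_schwartz_int (complexify Φ) (inv_pos.2 hN)
  simpa [complexify_apply, div_eq_mul_inv] using this

theorem summable_norm_triple {f g k : ℤ → ℂ} (hf : Summable fun x => ‖f x‖)
    (hg : Summable fun x => ‖g x‖) (hk : Summable fun x => ‖k x‖) :
    Summable fun x : ℤ × ℤ × ℤ => ‖f x.1 * g x.2.1 * k x.2.2‖ := by
  have hgk : Summable fun x : ℤ × ℤ => ‖g x.1 * k x.2‖ := Summable.mul_norm hg hk
  refine (Summable.mul_norm (f := f) (g := fun x : ℤ × ℤ => g x.1 * k x.2) hf hgk).congr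
    fun x => ?_
  rw [mul_assoc]

theorem tsum_triple {f g k : ℤ → ℂ} (hf : Summable fun x => ‖f x‖)
    (hg : Summable fun x => ‖g x‖) (hk : Summable fun x => ‖k x‖) :
    ∑' x : ℤ × ℤ × ℤ, f x.1 * g x.2.1 * k x.2.2 = (∑' x, f x) * (∑' x, g x) * ∑' x, k x := by
  have hgk : Summable fun x : ℤ × ℤ => ‖g x.1 * k x.2‖ := Summable.mul_norm hg hk
  rw [mul_assoc, tsum_mul_tsum_of_summable_norm hg hk, tsum_mul_tsum_of_summable_norm hf hgk]
  exact tsum_congr fun x => mul_assoc _ _ _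

theorem summable_weight (Φ : 𝓢(ℝ, ℝ)) {N : ℝ} (hN : 0 < N) : Summable (weight Φ N) := by
  have h : Summable fun x : ℤ => ‖(Φ (x / N) : ℂ)‖ := by
    simpa using summable_schwartz_div Φ hN
  refine Summable.of_norm ((summable_norm_triple h h h).congr fun x => ?_)
  rw [weight, ← Complex.ofReal_mul, ← Complex.ofReal_mul, Complex.norm_real]

theorem isUnit_intCast_zmod_pow_iff {p n : ℕ} (hn : n ≠ 0) {a : ℤ} :
    IsUnit (a : ZMod (p ^ n)) ↔ IsCoprime a (p : ℤ) := by
  rw [ZMod.coe_int_isUnit_iff_isCoprime, Nat.cast_pow,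
    IsCoprime.pow_left_iff (Nat.pos_of_ne_zero hn), isCoprime_comm]

theorem mem_solutions_iff {p n : ℕ} [NeZero (p ^ n)] (hn : n ≠ 0) {α₁ α₂ α₃ : ℤ}
    (x : ℤ × ℤ × ℤ) :
    x ∈ solutions p (p ^ n) α₁ α₂ α₃ ↔
      ((x.1 : ZMod (p ^ n)), (x.2.1 : ZMod (p ^ n)), (x.2.2 : ZMod (p ^ n))) ∈
        unitSolutions p n α₁ α₂ α₃ := by
  simp only [solutions, unitSolutions, Set.mem_ofPred_eq, Finset.mem_filter, Finset.mem_univ,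
    true_and, isUnit_intCast_zmod_pow_iff hn, IsCoprime.mul_left_iff, and_assoc,
    ← ZMod.intCast_eq_intCast_iff]
  push_cast
  rfl

/-- Poisson summation for the weighted count of solutions. -/
theorem tsum_solutions_eq {p n : ℕ} [Fact p.Prime] (hn : n ≠ 0) (α₁ α₂ α₃ : ℤ) (Φ : 𝓢(ℝ, ℝ))
    {N : ℝ} (hN : 0 < N) :
    ((∑' x : solutions p (p ^ n) α₁ α₂ α₃, weight Φ N (x : ℤ × ℤ × ℤ) : ℝ) : ℂ) =
      ((N / (p ^ n : ℕ) : ℝ) : ℂ) ^ 3 * ∑' h : ℤ × ℤ × ℤ,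
        𝓕 (complexify Φ) (h.1 * (N / (p ^ n : ℕ))) * 𝓕 (complexify Φ) (h.2.1 * (N / (p ^ n : ℕ))) *
          𝓕 (complexify Φ) (h.2.2 * (N / (p ^ n : ℕ))) * expSum p n α₁ α₂ α₃ h := by
  have hq : (0 : ℝ) < (p ^ n : ℕ) := by exact_mod_cast pow_pos (Fact.out : p.Prime).pos n
  set S := unitSolutions p n α₁ α₂ α₃ with hS
  set F : ZMod (p ^ n) → ℤ → ℂ := fun c x => if (x : ZMod (p ^ n)) = c then (Φ (x / N) : ℂ) else 0
    with hF
  set y := N / (p ^ n : ℕ) with hy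
  have hypos : 0 < y := div_pos hN hq
  set Ψ := 𝓕 (complexify Φ) with hΨ
  set A : ZMod (p ^ n) → ℤ → ℂ := fun c h => Ψ (h * y) * ZMod.stdAddChar ((h : ZMod (p ^ n)) * c)
    with hA
  have hsF : ∀ c, Summable fun x => ‖F c x‖ := by
    intro c
    refine Summable.of_nonneg_of_le (fun _ => norm_nonneg _) (fun x => ?_)
      (summable_schwartz_div Φ hN)
    simp only [hF]
    split_ifs
    · simp
    · simp
  have hsA : ∀ c, Summable fun h => ‖A c h‖ := by
    intro c
    refine (summable_norm_schwartz_int Ψ hypos).congr fun h => ?_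
    simp [hA, AddChar.norm_apply]
  -- Splitting by residue triple makes each summand a product over coordinates, so one-dimensional
  -- Poisson summation suffices.
  have hind : ∀ x : ℤ × ℤ × ℤ,
      (((solutions p (p ^ n) α₁ α₂ α₃).indicator (weight Φ N) x : ℝ) : ℂ) =
        ∑ c ∈ S, F c.1 x.1 * F c.2.1 x.2.1 * F c.2.2 x.2.2 := by
    intro x
    have hterm : ∀ c : ZMod (p ^ n) × ZMod (p ^ n) × ZMod (p ^ n),
        F c.1 x.1 * F c.2.1 x.2.1 * F c.2.2 x.2.2 =
        if ((x.1 : ZMod (p ^ n)), (x.2.1 : ZMod (p ^ n)), (x.2.2 : ZMod (p ^ n))) = c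
          then ((weight Φ N x : ℝ) : ℂ) else 0 := by
      rintro ⟨c1, c2, c3⟩
      simp only [hF, weight, Prod.mk.injEq]
      push_cast
      split_ifs <;> simp_all
    rw [Finset.sum_congr rfl fun c _ => hterm c, Finset.sum_ite_eq]
    by_cases hx : x ∈ solutions p (p ^ n) α₁ α₂ α₃
    · rw [Set.indicator_of_mem hx, if_pos ((mem_solutions_iff hn x).1 hx)]
    · rw [Set.indicator_of_notMem hx, if_neg (fun h => hx ((mem_solutions_iff hn x).2 h)),
        Complex.ofReal_zero]
  calc ((∑' x : solutions p (p ^ n) α₁ α₂ α₃, weight Φ N (x : ℤ × ℤ × ℤ) : ℝ) : ℂ)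
      = ∑' x : ℤ × ℤ × ℤ, ∑ c ∈ S, F c.1 x.1 * F c.2.1 x.2.1 * F c.2.2 x.2.2 := by
        rw [tsum_subtype, Complex.ofReal_tsum]
        exact tsum_congr hind
    _ = ∑ c ∈ S, ∑' x : ℤ × ℤ × ℤ, F c.1 x.1 * F c.2.1 x.2.1 * F c.2.2 x.2.2 :=
        Summable.tsum_finsetSum fun c _ => (summable_norm_triple (hsF _) (hsF _) (hsF _)).of_norm
    _ = ∑ c ∈ S, (y : ℂ) ^ 3 * ∑' h : ℤ × ℤ × ℤ, A c.1 h.1 * A c.2.1 h.2.1 * A c.2.2 h.2.2 := by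
        refine Finset.sum_congr rfl fun c _ => ?_
        rw [tsum_triple (hsF _) (hsF _) (hsF _), tsum_triple (hsA _) (hsA _) (hsA _)]
        simp only [hF, tsum_residue_class Φ hN]
        simp only [hA, hΨ, hy]
        ring
    _ = (y : ℂ) ^ 3 * ∑' h : ℤ × ℤ × ℤ, ∑ c ∈ S, A c.1 h.1 * A c.2.1 h.2.1 * A c.2.2 h.2.2 := by
        rw [← Finset.mul_sum, Summable.tsum_finsetSum fun c _ =>
          (summable_norm_triple (hsA _) (hsA _) (hsA _)).of_norm]
    _ = _ := by
        congr 1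
        refine tsum_congr fun h => ?_
        rw [expSum, Finset.mul_sum]
        refine Finset.sum_congr rfl fun c _ => ?_
        simp only [hA, linForm, AddChar.map_add_eq_mul]
        ring

/-- The weighted count of solutions differs from its expected value by the contribution of the
exponential sums at nonzero frequencies of height at most `X`, and a tail that decays like a
power of `B`. -/
theorem exists_tsum_solutions_sub_le (Φ : 𝓢(ℝ, ℝ)) (L : ℕ) :
    ∃ D : ℝ, 0 ≤ D ∧ ∀ (p n : ℕ) [Fact p.Prime], n ≠ 0 → ∀ (α₁ α₂ α₃ : ℤ) (N : ℝ), 1 ≤ N →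
      ∀ (X : ℕ) (B : ℝ), 0 < B → B ≤ (X + 1) * (N / (p : ℝ) ^ n) →
      |(∑' x : solutions p (p ^ n) α₁ α₂ α₃, weight Φ N (x : ℤ × ℤ × ℤ)) -
        (N / (p : ℝ) ^ n) ^ 3 * (fourierZero Φ ^ 3 * (unitSolutions p n α₁ α₂ α₃).card)| ≤
        (N / (p : ℝ) ^ n) ^ 3 * (D * (∑ h ∈ (box X).filter (fun h => h ≠ 0),
          ‖expSum p n α₁ α₂ α₃ h‖ + ((p : ℝ) ^ n) ^ 9 * (B ^ L)⁻¹)) := by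
  set Ψ := 𝓕 (complexify Φ) with hΨ
  -- Two powers of decay pay for summability, the other L for the saving B^(-L).
  obtain ⟨E, hE, hdecay⟩ := exists_norm_le_one_add_abs_pow Ψ (L + 2)
  set w : ℤ → ℝ := fun m => ((1 + |(m : ℝ)|) ^ 2)⁻¹ with hw
  have hw0 : ∀ m, 0 ≤ w m := fun m => by positivity
  have hwsum : Summable w := summable_inv_one_add_abs_sq
  have hwtriple : Summable fun h : ℤ × ℤ × ℤ => w h.1 * w h.2.1 * w h.2.2 := by
    have := (hwsum.mul_of_nonneg (hwsum.mul_of_nonneg hwsum hw0 hw0) hw0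
      (fun x => mul_nonneg (hw0 _) (hw0 _)))
    exact this.congr fun h => (mul_assoc _ _ _).symm
  set W := ∑' h : ℤ × ℤ × ℤ, w h.1 * w h.2.1 * w h.2.2 with hW
  have hW0 : 0 ≤ W := tsum_nonneg fun h => mul_nonneg (mul_nonneg (hw0 _) (hw0 _)) (hw0 _)
  refine ⟨E ^ 3 * (1 + W), by positivity, ?_⟩
  intro p n _ hn α₁ α₂ α₃ N hN X B hB hBX
  have hN0 : 0 < N := by linarith
  set q : ℝ := (p : ℝ) ^ n with hqdef
  have hq1 : 1 ≤ q := one_le_pow₀ (by exact_mod_cast (Fact.out : p.Prime).one_le)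
  have hq0 : 0 < q := by linarith
  set y := N / q with hy
  have hy0 : 0 < y := div_pos hN0 hq0
  have hyq : 1 / q ≤ y := by
    rw [hy]
    gcongr
  set G := expSum p n α₁ α₂ α₃ with hG
  have hmain := tsum_solutions_eq (p := p) hn α₁ α₂ α₃ Φ hN0
  rw [Nat.cast_pow, ← hqdef, ← hy, ← hΨ] at hmain
  set T := ∑' x : solutions p (p ^ n) α₁ α₂ α₃, weight Φ N (x : ℤ × ℤ × ℤ) with hT
  set V : ℤ × ℤ × ℤ → ℂ := fun h => Ψ (h.1 * y) * Ψ (h.2.1 * y) * Ψ (h.2.2 * y) * G h with hV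
  have hΨw : ∀ m : ℤ, ‖Ψ (m * y)‖ ≤ E * (q ^ 2 * w m) := by
    intro m
    refine (hdecay _).trans (mul_le_mul_of_nonneg_left ?_ hE)
    refine le_trans ?_ (inv_one_add_mul_sq_le hq1 hyq m)
    gcongr
    · have := abs_nonneg ((m : ℝ) * y)
      linarith
    · omega
  have hΨE : ∀ x : ℝ, ‖Ψ x‖ ≤ E := by
    intro x
    refine (hdecay _).trans (mul_le_of_le_one_right hE (inv_le_one_of_one_le₀ ?_))
    have := abs_nonneg x
    exact one_le_pow₀ (by linarith)
  have hΨfar : ∀ m : ℤ, (X : ℤ) < |m| → ‖Ψ (m * y)‖ ≤ E * (q ^ 2 * w m) * (B ^ L)⁻¹ := by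
    intro m hm
    have hm' : (X : ℝ) + 1 ≤ |(m : ℝ)| := by exact_mod_cast hm
    have hBm : B ≤ 1 + |(m : ℝ) * y| := by
      rw [abs_mul, abs_of_pos hy0]
      have := mul_le_mul_of_nonneg_right hm' hy0.le
      linarith
    refine (hdecay _).trans ?_
    rw [mul_assoc]
    refine mul_le_mul_of_nonneg_left ?_ hE
    rw [pow_add, mul_inv, mul_comm]
    refine mul_le_mul (inv_one_add_mul_sq_le hq1 hyq m) ?_ (by positivity) (by positivity)
    gcongr
  have hGq : ∀ h, ‖G h‖ ≤ q ^ 3 := fun h => norm_expSum_le_cube α₁ α₂ α₃ h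
  have hVsum : Summable V := by
    have h1 := (summable_norm_triple (summable_norm_schwartz_int Ψ hy0)
      (summable_norm_schwartz_int Ψ hy0) (summable_norm_schwartz_int Ψ hy0)).mul_right (q ^ 3)
    refine Summable.of_norm (Summable.of_nonneg_of_le (fun _ => norm_nonneg _) (fun h => ?_) h1)
    rw [hV, norm_mul]
    exact mul_le_mul_of_nonneg_left (hGq h) (norm_nonneg _)
  have hV0 : V 0 = ((fourierZero Φ ^ 3 * (unitSolutions p n α₁ α₂ α₃).card : ℝ) : ℂ) := by
    have hG0 : G 0 = ((unitSolutions p n α₁ α₂ α₃).card : ℂ) := by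
      simp [hG, expSum, linForm]
    have hΨ0 : Ψ 0 = (fourierZero Φ : ℂ) := fourier_complexify_zero Φ
    simp only [hV, Prod.fst_zero, Prod.snd_zero, Int.cast_zero, zero_mul, hG0, hΨ0]
    push_cast
    ring
  have hdiff : ((T - y ^ 3 * (fourierZero Φ ^ 3 * (unitSolutions p n α₁ α₂ α₃).card) : ℝ) : ℂ) =
      (y : ℂ) ^ 3 * ∑' h, (if h = 0 then 0 else V h) := by
    have hsplit := hVsum.tsum_eq_add_tsum_ite 0
    rw [Complex.ofReal_sub, hmain, hsplit, hV0]
    push_cast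
    ring
  rw [← Real.norm_eq_abs, ← Complex.norm_real, hdiff, norm_mul, norm_pow, Complex.norm_real,
    Real.norm_of_nonneg hy0.le]
  refine mul_le_mul_of_nonneg_left ?_ (by positivity)
  set P := (box X).filter (fun h : ℤ × ℤ × ℤ => h ≠ 0) with hP
  have hlow : HasSum (fun h => if h ∈ P then E ^ 3 * ‖G h‖ else 0) (∑ h ∈ P, E ^ 3 * ‖G h‖) := by
    have : HasSum (fun h => if h ∈ P then E ^ 3 * ‖G h‖ else 0)
        (∑ h ∈ P, if h ∈ P then E ^ 3 * ‖G h‖ else 0) :=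
      hasSum_sum_of_ne_finset_zero fun h hh => if_neg hh
    rwa [Finset.sum_congr rfl (fun h hh => if_pos hh)] at this
  have hhigh := (hwtriple.hasSum.mul_left (E ^ 3 * q ^ 9 * (B ^ L)⁻¹))
  refine (tsum_of_norm_bounded (hlow.add hhigh) fun h => ?_).trans ?_
  · have hnn : 0 ≤ E ^ 3 * q ^ 9 * (B ^ L)⁻¹ * (w h.1 * w h.2.1 * w h.2.2) :=
      mul_nonneg (by positivity) (mul_nonneg (mul_nonneg (hw0 _) (hw0 _)) (hw0 _))
    by_cases h0 : h = 0
    · rw [if_pos h0, norm_zero]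
      refine add_nonneg ?_ hnn
      split_ifs <;> positivity
    rw [if_neg h0, hV]
    simp only [norm_mul]
    by_cases hX : h ∈ box X
    · rw [if_pos (Finset.mem_filter.2 ⟨hX, h0⟩)]
      refine le_add_of_le_of_nonneg ?_ hnn
      refine mul_le_mul_of_nonneg_right ?_ (norm_nonneg _)
      calc _ ≤ E * E * E := by
            gcongr <;> exact hΨE _
        _ = E ^ 3 := by ring
    · rw [if_neg (fun hh => hX (Finset.mem_filter.1 hh).1), zero_add]
      rw [mem_box] at hX
      have a1 := hΨw h.1
      have a2 := hΨw h.2.1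
      have a3 := hΨw h.2.2
      have b1 : 0 ≤ E * (q ^ 2 * w h.1) := mul_nonneg hE (mul_nonneg (by positivity) (hw0 _))
      have b2 : 0 ≤ E * (q ^ 2 * w h.2.1) := mul_nonneg hE (mul_nonneg (by positivity) (hw0 _))
      have b3 : 0 ≤ E * (q ^ 2 * w h.2.2) := mul_nonneg hE (mul_nonneg (by positivity) (hw0 _))
      have hBL : 0 ≤ (B ^ L)⁻¹ := by positivity
      have key : ‖Ψ (h.1 * y)‖ * ‖Ψ (h.2.1 * y)‖ * ‖Ψ (h.2.2 * y)‖ ≤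
          (E * (q ^ 2 * w h.1)) * (E * (q ^ 2 * w h.2.1)) * (E * (q ^ 2 * w h.2.2)) *
            (B ^ L)⁻¹ := by
        by_cases c1 : |h.1| ≤ X
        · by_cases c2 : |h.2.1| ≤ X
          · have c3 : (X : ℤ) < |h.2.2| := lt_of_not_ge fun c3 => hX ⟨c1, c2, c3⟩
            calc _ ≤ (E * (q ^ 2 * w h.1)) * (E * (q ^ 2 * w h.2.1)) *
                  (E * (q ^ 2 * w h.2.2) * (B ^ L)⁻¹) := by
                  gcongr
                  exact hΨfar _ c3
              _ = _ := by ring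
          · calc _ ≤ (E * (q ^ 2 * w h.1)) * (E * (q ^ 2 * w h.2.1) * (B ^ L)⁻¹) *
                  (E * (q ^ 2 * w h.2.2)) := by
                  gcongr
                  exact hΨfar _ (lt_of_not_ge c2)
              _ = _ := by ring
        · calc _ ≤ (E * (q ^ 2 * w h.1) * (B ^ L)⁻¹) * (E * (q ^ 2 * w h.2.1)) *
                (E * (q ^ 2 * w h.2.2)) := by
                gcongr
                exact hΨfar _ (lt_of_not_ge c1)
            _ = _ := by ring
      calc _ ≤ (E * (q ^ 2 * w h.1)) * (E * (q ^ 2 * w h.2.1)) * (E * (q ^ 2 * w h.2.2)) *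
            (B ^ L)⁻¹ * q ^ 3 := by
            refine mul_le_mul key (hGq h) (norm_nonneg _) ?_
            exact mul_nonneg (mul_nonneg (mul_nonneg b1 b2) b3) hBL
        -- The q⁹ is q² from each of three decay factors times the trivial bound q³ for the
        -- exponential sum.
        _ = _ := by ring
  · rw [← Finset.mul_sum, ← hW]
    have hsum0 : 0 ≤ ∑ h ∈ P, ‖G h‖ := Finset.sum_nonneg fun _ _ => norm_nonneg _
    have e0 : 0 ≤ E ^ 3 * W * ∑ h ∈ P, ‖G h‖ := by positivity
    have e1 : 0 ≤ E ^ 3 * (q ^ 9 * (B ^ L)⁻¹) := by positivity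
    nlinarith [e0, e1]

/-! ### Choice of parameters and conclusion. -/

theorem C_pos {p : ℕ} [Fact p.Prime] {α₁ α₂ α₃ : ℤ} (hs : s p α₁ α₂ α₃ < (p : ℤ)) :
    0 < C p α₁ α₂ α₃ := by
  have hp : (1 : ℝ) < p := by exact_mod_cast (Fact.out : p.Prime).one_lt
  have hs' : (s p α₁ α₂ α₃ : ℝ) < p := by exact_mod_cast hs
  unfold C
  have h1 : 0 < (p : ℝ) - s p α₁ α₂ α₃ := by linarith
  have h2 : 0 < (p : ℝ) - 1 := by linarith
  positivity

theorem eq_zero_of_fourierZero_eq_zero {Φ : 𝓢(ℝ, ℝ)} (hΦ : ∀ x, 0 ≤ Φ x)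
    (h : fourierZero Φ = 0) (x : ℝ) : Φ x = 0 := by
  rw [fourierZero_eq_integral, MeasureTheory.integral_eq_zero_iff_of_nonneg hΦ Φ.integrable,
    Φ.continuous.ae_eq_iff_eq MeasureTheory.volume continuous_zero] at h
  exact congrFun h x

/-- The exponential sums at nonzero frequencies of height up to `q ^ (1 / 2 - ε / 2)` are
negligible compared with `q ^ 2`, where `q = p ^ n`. -/
theorem exists_sum_norm_expSum_le {ε : ℝ} (hε : 0 < ε) {p : ℕ} [Fact p.Prime] (hp : 2 < p)
    {α₁ α₂ α₃ : ℤ}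
    (h₁ : IsCoprime α₁ (p : ℤ)) (h₂ : IsCoprime α₂ (p : ℤ)) (h₃ : IsCoprime α₃ (p : ℤ)) :
    ∃ K : ℝ, 0 ≤ K ∧ ∀ n : ℕ, n ≠ 0 →
      (p : ℝ) * (|(α₂ * α₃ : ℝ)| + |(α₁ * α₃ : ℝ)| + |(α₁ * α₂ : ℝ)|) < ((p : ℝ) ^ n) ^ ε →
      ∑ h ∈ (box ⌊((p : ℝ) ^ n) ^ (1 / 2 - ε / 2 : ℝ)⌋₊).filter (fun h => h ≠ 0),
        ‖expSum p n α₁ α₂ α₃ h‖ ≤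
        K * ((n : ℝ) ^ 2 * ((p : ℝ) ^ n) ^ (2 - ε / 2 : ℝ)) := by
  obtain ⟨K, hK⟩ := sum_norm_expSum_le hp h₁ h₂ h₃
  have hp1 : (1 : ℝ) ≤ p := by exact_mod_cast (Fact.out : p.Prime).one_le
  have hp0 : (0 : ℝ) < p := by linarith
  -- The p² absorbs the rounding in n + ⌈n/2⌉ + 1, and 4p comes from the logarithmic factors 2n and
  -- 2np.
  refine ⟨p ^ 2 * K * (4 * p), by positivity, fun n hn hlarge => ?_⟩
  set q : ℝ := (p : ℝ) ^ n with hq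
  have hq1 : 1 ≤ q := one_le_pow₀ hp1
  have hq0 : 0 < q := by linarith
  set X := ⌊q ^ (1 / 2 - ε / 2 : ℝ)⌋₊ with hX
  have hXle : (X : ℝ) ≤ q ^ (1 / 2 - ε / 2 : ℝ) := Nat.floor_le (by positivity)
  have hXq : (X : ℝ) ≤ q := by
    refine hXle.trans ?_
    conv_rhs => rw [← Real.rpow_one q]
    exact Real.rpow_le_rpow_of_exponent_le hq1 (by linarith)
  have hXq' : X ≤ p ^ n := by
    rw [hq] at hXq
    exact_mod_cast hXq
  have hsmall : (p : ℤ) * (|α₂ * α₃| + |α₁ * α₃| + |α₁ * α₂|) * (X : ℤ) ^ 2 < (p : ℤ) ^ n := by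
    have hX2 : (X : ℝ) ^ 2 ≤ q ^ (1 - ε) := by
      calc (X : ℝ) ^ 2 ≤ (q ^ (1 / 2 - ε / 2 : ℝ)) ^ 2 := by gcongr
        _ = q ^ (1 - ε) := by
            rw [← Real.rpow_natCast, ← Real.rpow_mul hq0.le]
            congr 1
            push_cast
            ring
    have : (p : ℝ) * (|(α₂ * α₃ : ℝ)| + |(α₁ * α₃ : ℝ)| + |(α₁ * α₂ : ℝ)|) * (X : ℝ) ^ 2 < q := by
      calc _ ≤ (p : ℝ) * (|(α₂ * α₃ : ℝ)| + |(α₁ * α₃ : ℝ)| + |(α₁ * α₂ : ℝ)|) * q ^ (1 - ε) := by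
            gcongr
        _ < q ^ ε * q ^ (1 - ε) := by gcongr
        _ = q := by
            rw [← Real.rpow_add hq0, add_sub_cancel, Real.rpow_one]
    rw [hq] at this
    exact_mod_cast this
  refine (hK n hn X hsmall).trans ?_
  have hn1 : (1 : ℝ) ≤ n := by exact_mod_cast Nat.one_le_iff_ne_zero.2 hn
  have hlogp : Real.log p ≤ p := (Real.log_le_sub_one_of_pos hp0).trans (by linarith)
  have hlog1 : (Nat.log p X : ℝ) + 1 ≤ 2 * n := by
    have : Nat.log p X ≤ n := by
      have := Nat.log_mono_right (b := p) hXq'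
      rwa [Nat.log_pow (by omega)] at this
    have : (Nat.log p X : ℝ) ≤ n := by exact_mod_cast this
    linarith
  have hlog2 : 1 + Real.log X ≤ 2 * n * p := by
    have h1 : Real.log X ≤ n * p := by
      -- X = 0 does occur, when ε > 1; then `Real.log 0 = 0`.
      rcases Nat.eq_zero_or_pos X with h0 | h0
      · rw [h0, Nat.cast_zero, Real.log_zero]
        positivity
      · calc Real.log X ≤ Real.log q := Real.log_le_log (by exact_mod_cast h0) hXq
          _ = n * Real.log p := by rw [hq, Real.log_pow]
          _ ≤ n * p := by gcongr
    nlinarith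
  have hlog0 : 0 ≤ 1 + Real.log X := by
    have := Real.log_natCast_nonneg X
    linarith
  have hpow : (p : ℝ) ^ (n + (n + 1) / 2 + 1) ≤ p ^ 2 * q ^ (3 / 2 : ℝ) := by
    have h1 : ((n + (n + 1) / 2 + 1 : ℕ) : ℝ) ≤ 2 + n * (3 / 2) := by
      have : (((n + 1) / 2 : ℕ) : ℝ) ≤ ((n + 1 : ℕ) : ℝ) / 2 := Nat.cast_div_le
      push_cast at this ⊢
      linarith
    calc (p : ℝ) ^ (n + (n + 1) / 2 + 1) = (p : ℝ) ^ ((n + (n + 1) / 2 + 1 : ℕ) : ℝ) :=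
          (Real.rpow_natCast _ _).symm
      _ ≤ (p : ℝ) ^ (2 + n * (3 / 2) : ℝ) := Real.rpow_le_rpow_of_exponent_le hp1 h1
      _ = p ^ 2 * q ^ (3 / 2 : ℝ) := by
          rw [Real.rpow_add hp0, Real.rpow_mul hp0.le, Real.rpow_natCast, ← hq, Real.rpow_two]
  calc (p : ℝ) ^ (n + (n + 1) / 2 + 1) * (K * X * ((Nat.log p X + 1) * (1 + Real.log X)))
      ≤ (p ^ 2 * q ^ (3 / 2 : ℝ)) * (K * q ^ (1 / 2 - ε / 2 : ℝ) * ((2 * n) * (2 * n * p))) := by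
        gcongr
    _ = p ^ 2 * K * (4 * p) * (n ^ 2 * (q ^ (3 / 2 : ℝ) * q ^ (1 / 2 - ε / 2 : ℝ))) := by ring
    _ = p ^ 2 * K * (4 * p) * (n ^ 2 * q ^ (2 - ε / 2 : ℝ)) := by
        rw [← Real.rpow_add hq0, show (3 / 2 : ℝ) + (1 / 2 - ε / 2) = 2 - ε / 2 by ring]

end QuadCong

end

theorem theorem1 (ε : ℝ) (hε : 0 < ε) (p : ℕ) [Fact p.Prime] (hp : 2 < p)
    (α₁ α₂ α₃ : ℤ)
    (h₁ : IsCoprime α₁ (p : ℤ)) (h₂ : IsCoprime α₂ (p : ℤ)) (h₃ : IsCoprime α₃ (p : ℤ))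
    (hs : QuadCong.s p α₁ α₂ α₃ < (p : ℤ))
    (Φ : 𝓢(ℝ, ℝ)) (hΦ : ∀ x, 0 ≤ Φ x) :
    (∀ (n : ℕ) (N : ℝ), 0 < N →
      Summable (fun x : QuadCong.solutions p (p ^ n) α₁ α₂ α₃ =>
        QuadCong.weight Φ N (x : ℤ × ℤ × ℤ))) ∧
    ∀ δ : ℝ, 0 < δ → ∃ n₀ : ℕ, ∀ n : ℕ, n₀ ≤ n → ∀ N : ℝ,
      ((p : ℝ) ^ n) ^ (1 / 2 + ε : ℝ) ≤ N →
      |(∑' x : QuadCong.solutions p (p ^ n) α₁ α₂ α₃,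
            QuadCong.weight Φ N (x : ℤ × ℤ × ℤ)) -
          QuadCong.fourierZero Φ ^ 3 * QuadCong.C p α₁ α₂ α₃ * (N ^ 3 / (p : ℝ) ^ n)| ≤
        δ * (QuadCong.fourierZero Φ ^ 3 * QuadCong.C p α₁ α₂ α₃ * (N ^ 3 / (p : ℝ) ^ n)) := by
  refine ⟨fun n N hN => (QuadCong.summable_weight Φ hN).subtype _, fun δ hδ => ?_⟩
  -- Here M = 0 permits no error, but Φ, nonnegative and continuous with zero integral, vanishes
  -- identically.
  by_cases hΦ0 : QuadCong.fourierZero Φ = 0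
  · refine ⟨0, fun n _ N _ => ?_⟩
    have hzero : ∀ x : ℤ × ℤ × ℤ, QuadCong.weight Φ N x = 0 := fun x => by
      simp [QuadCong.weight, QuadCong.eq_zero_of_fourierZero_eq_zero hΦ hΦ0]
    simp [hzero, hΦ0]
  have hfpos : 0 < QuadCong.fourierZero Φ := by
    refine lt_of_le_of_ne ?_ (Ne.symm hΦ0)
    rw [QuadCong.fourierZero_eq_integral]
    exact MeasureTheory.integral_nonneg hΦ
  have hCpos := QuadCong.C_pos hs
  have hp1 : (1 : ℝ) < p := by exact_mod_cast (Fact.out : p.Prime).one_lt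
  have hp0 : (0 : ℝ) < p := by linarith
  obtain ⟨K, hK0, hK⟩ := QuadCong.exists_sum_norm_expSum_le hε hp h₁ h₂ h₃
  -- Then (ε/2)L ≥ 8, so the tail q⁹ q^(-εL/2) is at most q, a factor q below the main size q².
  set L := ⌈16 / ε⌉₊ with hL
  have hLε : 16 ≤ L * ε := by
    have := Nat.le_ceil (16 / ε)
    rwa [div_le_iff₀ hε] at this
  obtain ⟨D, hD0, hD⟩ := QuadCong.exists_tsum_solutions_sub_le Φ L
  set η := δ * (QuadCong.fourierZero Φ ^ 3 * QuadCong.C p α₁ α₂ α₃) with hη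
  have hηpos : 0 < η := by positivity
  have hlim : Filter.Tendsto (fun n : ℕ => D * (K * ((n : ℝ) ^ 2 * ((p : ℝ) ^ (-(ε / 2))) ^ n) +
      ((p : ℝ)⁻¹) ^ n)) Filter.atTop (nhds 0) := by
    have t1 := tendsto_pow_const_mul_const_pow_of_abs_lt_one 2 (r := (p : ℝ) ^ (-(ε / 2))) (by
      rw [abs_of_pos (by positivity)]
      exact Real.rpow_lt_one_of_one_lt_of_neg hp1 (by linarith))
    have t2 := tendsto_pow_atTop_nhds_zero_of_lt_one (inv_nonneg.2 hp0.le) (inv_lt_one_of_one_lt₀ hp1)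
    have := ((t1.const_mul K).add t2).const_mul D
    simpa using this
  have hgrow : Filter.Tendsto (fun n : ℕ => ((p : ℝ) ^ ε) ^ n) Filter.atTop Filter.atTop :=
    tendsto_pow_atTop_atTop_of_one_lt (Real.one_lt_rpow hp1 hε)
  obtain ⟨n₀, hn₀⟩ := Filter.eventually_atTop.1 ((hlim.eventually_lt_const hηpos).and
    ((hgrow.eventually_gt_atTop ((p : ℝ) *
      (|(α₂ * α₃ : ℝ)| + |(α₁ * α₃ : ℝ)| + |(α₁ * α₂ : ℝ)|))).and (Filter.eventually_ne_atTop 0)))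
  refine ⟨n₀, fun n hn N hN => ?_⟩
  obtain ⟨hsmall, hlarge, hn0⟩ := hn₀ n hn
  set q : ℝ := (p : ℝ) ^ n with hq
  have hq1 : 1 ≤ q := one_le_pow₀ hp1.le
  have hq0 : 0 < q := by linarith
  have hcomm : ∀ t : ℝ, ((p : ℝ) ^ t) ^ n = q ^ t := by
    intro t
    rw [hq, ← Real.rpow_natCast, ← Real.rpow_natCast, ← Real.rpow_mul hp0.le,
      ← Real.rpow_mul hp0.le, mul_comm]
  rw [hcomm] at hsmall hlarge
  have hN1 : 1 ≤ N := (Real.one_le_rpow hq1 (by linarith)).trans hN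
  -- The one use of the full range N ≥ q^(1/2+ε): beyond the cutoff, the argument of Φ̂ is at least
  -- q^(ε/2).
  have hB : q ^ (ε / 2) ≤ (⌊q ^ (1 / 2 - ε / 2 : ℝ)⌋₊ + 1) * (N / q) := by
    calc q ^ (ε / 2) = q ^ (1 / 2 - ε / 2 : ℝ) * (q ^ (1 / 2 + ε : ℝ) / q) := by
          rw [← Real.rpow_sub_one hq0.ne', ← Real.rpow_add hq0]
          congr 1
          ring
      _ ≤ (⌊q ^ (1 / 2 - ε / 2 : ℝ)⌋₊ + 1) * (N / q) := by
          gcongr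
          exact (Nat.lt_floor_add_one _).le
  have hmain := hD p n hn0 α₁ α₂ α₃ N hN1 _ (q ^ (ε / 2)) (by positivity) hB
  have hlow := hK n hn0 hlarge
  rw [QuadCong.card_unitSolutions hp hn0 h₁ h₂ h₃, ← hq] at hmain
  rw [show (N / q) ^ 3 * (QuadCong.fourierZero Φ ^ 3 * (QuadCong.C p α₁ α₂ α₃ * q ^ 2)) =
    QuadCong.fourierZero Φ ^ 3 * QuadCong.C p α₁ α₂ α₃ * (N ^ 3 / q) by field_simp] at hmain
  refine hmain.trans ?_
  have htail : q ^ 9 * ((q ^ (ε / 2)) ^ L)⁻¹ ≤ q ^ 2 * (p : ℝ)⁻¹ ^ n := by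
    rw [inv_pow, ← hq, ← Real.rpow_natCast (q ^ (ε / 2)), ← Real.rpow_mul hq0.le,
      ← Real.rpow_neg hq0.le, ← Real.rpow_natCast q 9, ← Real.rpow_add hq0]
    calc q ^ (((9 : ℕ) : ℝ) + -(ε / 2 * L)) ≤ q ^ (1 : ℝ) := by
          refine Real.rpow_le_rpow_of_exponent_le hq1 ?_
          push_cast
          linarith
      _ = q ^ 2 * q⁻¹ := by
          rw [Real.rpow_one]
          field_simp
  have hsplit : q ^ (2 - ε / 2 : ℝ) = q ^ 2 * q ^ (-(ε / 2)) := by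
    rw [sub_eq_add_neg, Real.rpow_add hq0]
    norm_num
  calc _ ≤ (N / q) ^ 3 * (D * (K * ((n : ℝ) ^ 2 * q ^ (2 - ε / 2 : ℝ)) +
          q ^ 2 * (p : ℝ)⁻¹ ^ n)) := by gcongr
    _ = (N ^ 3 / q) * (D * (K * ((n : ℝ) ^ 2 * q ^ (-(ε / 2))) + (p : ℝ)⁻¹ ^ n)) := by
        rw [hsplit]
        field_simp
    _ ≤ (N ^ 3 / q) * η := by gcongr
    _ = _ := by
        rw [hη]
        ring
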